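/- For positive integers $n$ and $k$, let $X_{n,k}$ be the number of fringe subtrees of size $k$ in the random binary search tree with $n$ nodes (built by inserting $n$ distinct keys in uniformly random order), and let $\hat X_{n,k}$ be the number of fringe subtrees of size $k$ in the random recursive tree with $n$ nodes (grown from the root by attaching, one at a time, each new node to a uniformly random earlier node, independently of the previous choices). Here a fringe subtree consists of a node together with all its descendants, and its size is its number of nodes. Let $k=k_n\ge 1$ be integers with $k_n=o(\sqrt n)$ as $n\to\infty$. Then, as $n\to\infty$, $$\frac{X_{n,k_n}-\mathbb E(X_{n,k_n})}{\sqrt{\operatorname{Var}(X_{n,k_n})}}\xrightarrow{\ d\ }\mathcal N(0,1)$$ and $$\frac{\hat X_{n,k_n}-\mathbb E(\hat X_{n,k_n})}{\sqrt{\operatorname{Var}(\hat X_{n,k_n})}}\xrightarrow{\ d\ }\mathcal N(0,1),$$ where $\xrightarrow{\ d\ }$ denotes convergence in distribution. -/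

import Mathlib

open MeasureTheory ProbabilityTheory Filter Asymptotics

namespace FringeTrees

/-! ### Random binary search trees -/

/-- Insertion of a new key in a binary search tree: starting at the root, the key proceeds to the
left child if it is smaller than the key at the node visited and to the right child if it is
larger, until it reaches an empty place. -/
def bstInsert (t : BinaryTree ℕ) (x : ℕ) : BinaryTree ℕ :=
  match t with
  | .nil => .node x .nil .nil
  | .node a l r => if x < a then .node a (bstInsert l x) r else .node a l (bstInsert r x)

/-- The binary search tree built by inserting the keys of a list one after another. -/
def bstOfList (keys : List ℕ) : BinaryTree ℕ :=
  keys.foldl bstInsert .nil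

/-- The binary search tree with `n` nodes obtained when the keys are drawn in the order
`σ 0, σ 1, …, σ (n - 1)`. -/
def bst {n : ℕ} (σ : Equiv.Perm (Fin n)) : BinaryTree ℕ :=
  bstOfList (List.ofFn fun i => (σ i : ℕ))

/-- The fringe subtrees of a binary tree, one for each node: the node together with all its
descendants. -/
def fringeSubtrees : BinaryTree ℕ → List (BinaryTree ℕ)
  | .nil => []
  | .node a l r => .node a l r :: (fringeSubtrees l ++ fringeSubtrees r)

/-- The number of fringe subtrees of size `k` (i.e. with `k` nodes) in a binary tree. -/
def fringeCount (k : ℕ) (t : BinaryTree ℕ) : ℕ :=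
  (fringeSubtrees t).countP fun s => s.numNodes = k

/-- All events are measurable in the finite set of permutations. -/
instance permMeasurableSpace (n : ℕ) : MeasurableSpace (Equiv.Perm (Fin n)) := ⊤

instance permDiscrete (n : ℕ) : DiscreteMeasurableSpace (Equiv.Perm (Fin n)) :=
  ⟨fun _ => trivial⟩

/-- The keys are drawn in uniformly random order; `bst σ` is then the random binary search tree
with `n` nodes. -/
noncomputable def bstMeasure (n : ℕ) : Measure (Equiv.Perm (Fin n)) :=
  uniformOn Set.univ

instance bstMeasure_isProbabilityMeasure (n : ℕ) : IsProbabilityMeasure (bstMeasure n) := by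
  unfold bstMeasure; infer_instance

/-- The number `X_{n,k}` of fringe subtrees of size `k` in the random binary search tree with
`n` nodes. -/
def bstCount (n k : ℕ) (σ : Equiv.Perm (Fin n)) : ℝ :=
  (fringeCount k (bst σ) : ℝ)

/-! ### Random recursive trees

The nodes of a recursive tree with `n` nodes are labelled here `0, 1, …, n - 1`, with root `0`. -/

/-- The choices made when a recursive tree with `n` nodes is grown: the node `i + 1`
is attached to the node `p i`, one of the previous nodes `0, …, i`. -/
abbrev Attachments (n : ℕ) : Type :=
  (i : Fin (n - 1)) → Fin ((i : ℕ) + 1)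

/-- The parent of a node in the recursive tree (with the convention that the root is its own
parent). -/
def rrtParent {n : ℕ} (p : Attachments n) (v : Fin n) : Fin n :=
  if h : (v : ℕ) = 0 then v
  else ⟨p ⟨(v : ℕ) - 1, by omega⟩, by
    have := (p ⟨(v : ℕ) - 1, by omega⟩).isLt
    simp only at this
    omega⟩

/-- The set of nodes of the fringe subtree of a recursive tree rooted at `v`: the node `v` and all
its descendants, i.e. all `w` from which `v` is reached by moving to the parent some number of
times. -/
def rrtSubtree {n : ℕ} (p : Attachments n) (v : Fin n) : Set (Fin n) :=
  {w | ∃ m : ℕ, (rrtParent p)^[m] w = v}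

/-- Each new node is attached uniformly at random to one of the previous nodes, independently of
the earlier choices; this is the uniform distribution on the (finite) product of the sets
of possible choices. -/
noncomputable def rrtMeasure (n : ℕ) : Measure (Attachments n) :=
  uniformOn Set.univ

instance rrtMeasure_isProbabilityMeasure (n : ℕ) : IsProbabilityMeasure (rrtMeasure n) := by
  unfold rrtMeasure; infer_instance

/-- The number of fringe subtrees of size `k` in the random recursive tree with `n` nodes. -/
noncomputable def rrtCount (n k : ℕ) (p : Attachments n) : ℝ :=
  ({v : Fin n | (rrtSubtree p v).ncard = k}.ncard : ℝ)

/-! ### Standardization -/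

/-- The standardized random variable `(X - E X) / √(Var X)`. -/
noncomputable def standardize {Ω : Type*} [MeasurableSpace Ω] (X : Ω → ℝ) (μ : Measure Ω)
    (ω : Ω) : ℝ :=
  (X ω - ∫ ω', X ω' ∂μ) / √(variance X μ)

end FringeTrees

/-! Both random trees come from one model: a binary tree grown from the empty tree by filling a
uniformly random empty place at each step. For the search tree this holds because the relative rank
of the last key is uniform and independent of the earlier order (`sum_perm_shape_bst`). For the
recursive tree it holds after encoding the forest of non-root nodes as a binary tree with one node
fewer (`sum_attachments_shape`). Unless the whole tree has size k, both counts become `childCount K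
b`, with K = k + 1, b = 1 for the search tree and K = k, b = 0 for the recursive tree
(`fringeCount_eq`, `rrtCount_eq`).

In the grown tree the root splits the remaining nodes uniformly, and the two parts are independent
given their sizes (`treeMean_succ`). This gives a quicksort recursion for the centred count, with
toll `splitToll`. The mean is exactly affine in n from K on, the variance V is exactly proportional
to n + 1 from 2K on (`treeVariance_eq`), and its slope is at least of order K⁻²
(`le_varianceSlope`).

The characteristic function is compared with the Gaussian one of the same variance. The latter
satisfies the same recursion up to a third-order error (`gaussChar_recursion`): the first-order
terms cancel by the recursion of the means, the second-order terms by that of the variances. The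
comparison lemma `le_affine_of_recursion` turns this into a bound C|s|³V, with C free of n and K
(`norm_centredChar_sub_gaussChar_le`). At s = t/√V the bound is C|t|³/√V, which vanishes because k =
o(√n) forces V → ∞. -/

namespace FringeTrees

/-! ### Growth of binary trees -/

/-- The sum of `f` over all binary trees obtained from a given one by replacing one of its empty
places by a node. -/
def growSum {R : Type*} [Add R] : BinaryTree Unit → (BinaryTree Unit → R) → R
  | .nil, f => f (.node () .nil .nil)
  | .node _ l r, f =>
    growSum l (fun l' => f (.node () l' r)) + growSum r (fun r' => f (.node () l r'))

/-- The sum of `f` over all outcomes of `N` successive growth steps. -/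
def growthSum {R : Type*} [Add R] : ℕ → (BinaryTree Unit → R) → BinaryTree Unit → R
  | 0, f => f
  | N + 1, f => growthSum N fun t => growSum t f

section Growth

variable {R : Type*} [CommRing R]

lemma growSum_add (t : BinaryTree Unit) (f g : BinaryTree Unit → R) :
    growSum t (fun x => f x + g x) = growSum t f + growSum t g := by
  induction t generalizing f g with
  | nil => rfl
  | node a l r hl hr => simp only [growSum, hl, hr]; ring

lemma growSum_mul (t : BinaryTree Unit) (c : R) (f : BinaryTree Unit → R) :
    growSum t (fun x => c * f x) = c * growSum t f := by
  induction t generalizing f with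
  | nil => rfl
  | node a l r hl hr => simp only [growSum, hl, hr]; ring

lemma growSum_const (t : BinaryTree Unit) (c : R) :
    growSum t (fun _ => c) = (t.numNodes + 1) * c := by
  induction t with
  | nil => simp [growSum]
  | node a l r hl hr => simp only [growSum, hl, hr, BinaryTree.numNodes]; push_cast; ring

lemma growSum_congr (t : BinaryTree Unit) {f g : BinaryTree Unit → R}
    (h : ∀ x, x.numNodes = t.numNodes + 1 → f x = g x) : growSum t f = growSum t g := by
  induction t generalizing f g with
  | nil => exact h _ rfl
  | node a l r hl hr =>
    simp only [growSum]
    rw [hl (g := fun l' => g (.node () l' r)), hr (g := fun r' => g (.node () l r'))]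
    · intro x hx; apply h; simp only [BinaryTree.numNodes, hx]; ring
    · intro x hx; apply h; simp only [BinaryTree.numNodes, hx]; ring

lemma growSum_comm (l r : BinaryTree Unit) (F : BinaryTree Unit → BinaryTree Unit → R) :
    growSum l (fun l' => growSum r (F l')) = growSum r (fun r' => growSum l (fun l' => F l' r')) := by
  induction l generalizing F with
  | nil => rfl
  | node a l₁ l₂ h₁ h₂ =>
    simp only [growSum, h₁, h₂, growSum_add]

lemma growthSum_add (N : ℕ) (f g : BinaryTree Unit → R) (t : BinaryTree Unit) :
    growthSum N (fun x => f x + g x) t = growthSum N f t + growthSum N g t := by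
  induction N generalizing f g with
  | zero => rfl
  | succ N ih => simp only [growthSum, growSum_add, ih]

lemma growthSum_mul (N : ℕ) (c : R) (f : BinaryTree Unit → R) (t : BinaryTree Unit) :
    growthSum N (fun x => c * f x) t = c * growthSum N f t := by
  induction N generalizing f with
  | zero => rfl
  | succ N ih => simp only [growthSum, growSum_mul, ih]

lemma growthSum_congr (N : ℕ) (t : BinaryTree Unit) {f g : BinaryTree Unit → R}
    (h : ∀ x, x.numNodes = t.numNodes + N → f x = g x) : growthSum N f t = growthSum N g t := by
  induction N generalizing f g with
  | zero => exact h _ rfl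
  | succ N ih =>
    refine ih fun x hx => growSum_congr x fun y hy => h y ?_
    omega

lemma growthSum_one (N : ℕ) : growthSum N (fun _ => (1 : R)) .nil = N.factorial := by
  induction N with
  | zero => simp [growthSum]
  | succ N ih =>
    have : growthSum N (fun t => growSum t fun _ => (1 : R)) .nil
        = growthSum N (fun _ => ((N : R) + 1) * 1) .nil := by
      refine growthSum_congr N _ fun x hx => ?_
      rw [growSum_const, hx]; simp
    rw [growthSum, this, growthSum_mul, ih, Nat.factorial_succ]
    push_cast; ring

/-- Growth in the left subtree, as an operator on functions of a pair of subtrees. -/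
def growLeft : Module.End R (BinaryTree Unit × BinaryTree Unit → R) where
  toFun F p := growSum p.1 fun l => F (l, p.2)
  map_add' F G := by ext p; simp [growSum_add]
  map_smul' c F := by ext p; simp [growSum_mul]

/-- Growth in the right subtree, as an operator on functions of a pair of subtrees. -/
def growRight : Module.End R (BinaryTree Unit × BinaryTree Unit → R) where
  toFun F p := growSum p.2 fun r => F (p.1, r)
  map_add' F G := by ext p; simp [growSum_add]
  map_smul' c F := by ext p; simp [growSum_mul]

lemma commute_growLeft_growRight :
    Commute (growLeft (R := R)) growRight := by
  refine LinearMap.ext fun F => funext fun p => ?_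
  exact growSum_comm p.1 p.2 fun l r => F (l, r)

lemma growLeft_pow_apply (N : ℕ) (F : BinaryTree Unit × BinaryTree Unit → R)
    (p : BinaryTree Unit × BinaryTree Unit) :
    (growLeft ^ N) F p = growthSum N (fun l => F (l, p.2)) p.1 := by
  induction N generalizing F with
  | zero => rfl
  | succ N ih => rw [pow_succ, Module.End.mul_apply, ih]; rfl

lemma growRight_pow_apply (N : ℕ) (F : BinaryTree Unit × BinaryTree Unit → R)
    (p : BinaryTree Unit × BinaryTree Unit) :
    (growRight ^ N) F p = growthSum N (fun r => F (p.1, r)) p.2 := by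
  induction N generalizing F with
  | zero => rfl
  | succ N ih => rw [pow_succ, Module.End.mul_apply, ih]; rfl

/-- Once the root is present, every step grows exactly one of its two subtrees, so a step is the sum
of two operators on functions of the pair. -/
lemma growthSum_node_eq_pow (N : ℕ) (f : BinaryTree Unit → R) (l r : BinaryTree Unit) :
    growthSum N f (.node () l r)
      = ((growLeft + growRight : Module.End R (BinaryTree Unit × BinaryTree Unit → R)) ^ N)
          (fun p => f (.node () p.1 p.2)) (l, r) := by
  induction N generalizing f with
  | zero => rfl
  | succ N ih => rw [growthSum, ih, pow_succ, Module.End.mul_apply]; rfl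

/-- Leibniz rule for the growth of the two subtrees of the root. -/
lemma growthSum_node (N : ℕ) (f : BinaryTree Unit → R) (l r : BinaryTree Unit) :
    growthSum N f (.node () l r) = ∑ i ∈ Finset.range (N + 1), (N.choose i : R) *
      growthSum i (fun l' => growthSum (N - i) (fun r' => f (.node () l' r')) r) l := by
  -- The two growth operators commute, so the binomial theorem applies; the binomial coefficient
  -- counts the interleavings of left and right steps.
  rw [growthSum_node_eq_pow, commute_growLeft_growRight.add_pow]
  simp only [LinearMap.sum_apply, Finset.sum_apply]
  refine Finset.sum_congr rfl fun i _ => ?_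
  rw [← (Nat.cast_commute (N.choose i) _).eq, Module.End.mul_apply]
  have : ((N.choose i : ℕ) : Module.End R (BinaryTree Unit × BinaryTree Unit → R))
      = (N.choose i : R) • 1 := by
    rw [Nat.cast_smul_eq_nsmul, nsmul_one]
  rw [this, LinearMap.smul_apply, Module.End.one_apply, Pi.smul_apply, smul_eq_mul,
    Module.End.mul_apply, growLeft_pow_apply]
  simp only [growRight_pow_apply]

end Growth

/-! ### Averages over the random grown tree. -/

section Mean

variable {R : Type*} [Field R]

/-- The expectation of `f` at the random binary tree with `N` nodes grown from the empty tree by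
filling, again and again, a uniformly random empty place. -/
def treeMean (N : ℕ) (f : BinaryTree Unit → R) : R :=
  growthSum N f .nil / N.factorial

lemma treeMean_zero (f : BinaryTree Unit → R) : treeMean 0 f = f .nil := by
  simp [treeMean, growthSum]

lemma treeMean_add (N : ℕ) (f g : BinaryTree Unit → R) :
    treeMean N (fun x => f x + g x) = treeMean N f + treeMean N g := by
  simp [treeMean, growthSum_add, add_div]

lemma treeMean_mul (N : ℕ) (c : R) (f : BinaryTree Unit → R) :
    treeMean N (fun x => c * f x) = c * treeMean N f := by
  simp [treeMean, growthSum_mul, mul_div_assoc]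

lemma treeMean_congr (N : ℕ) {f g : BinaryTree Unit → R}
    (h : ∀ x, x.numNodes = N → f x = g x) : treeMean N f = treeMean N g := by
  unfold treeMean
  rw [growthSum_congr N _ fun x hx => h x (by simpa using hx)]

variable [CharZero R]

lemma treeMean_const (N : ℕ) (c : R) : treeMean N (fun _ => c) = c := by
  have := treeMean_mul N c fun _ => (1 : R)
  simp only [mul_one] at this
  have h0 : (N.factorial : R) ≠ 0 := by exact_mod_cast N.factorial_ne_zero
  rw [this, treeMean, growthSum_one, div_self h0, mul_one]

/-- The sizes of the two subtrees of the root are uniformly distributed, and given their sizes,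
the subtrees are independent random trees. -/
lemma treeMean_succ (N : ℕ) (f : BinaryTree Unit → R) :
    treeMean (N + 1) f = (∑ i ∈ Finset.range (N + 1),
      treeMean i fun l => treeMean (N - i) fun r => f (.node () l r)) / (N + 1) := by
  have h : growthSum (N + 1) f .nil = growthSum N f (.node () .nil .nil) := by
    have key : ∀ (N : ℕ) (f : BinaryTree Unit → R),
        growthSum (N + 1) f .nil = growthSum N f (.node () .nil .nil) := by
      intro N
      induction N with
      | zero => intro f; rfl
      | succ N ih => intro f; rw [growthSum, ih]; rfl
    exact key N f
  have h1 : ((N : R) + 1) ≠ 0 := by exact_mod_cast N.succ_ne_zero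
  have h2 : (N.factorial : R) ≠ 0 := by exact_mod_cast N.factorial_ne_zero
  rw [treeMean, h, growthSum_node, Nat.factorial_succ, Nat.cast_mul, Finset.sum_div,
    Finset.sum_div]
  refine Finset.sum_congr rfl fun i hi => ?_
  have hi' : i ≤ N := by simpa [Nat.lt_succ_iff] using hi
  have h3 : (i.factorial : R) ≠ 0 := by exact_mod_cast i.factorial_ne_zero
  have h4 : ((N - i).factorial : R) ≠ 0 := by exact_mod_cast (N - i).factorial_ne_zero
  have h5 : treeMean i (fun l => treeMean (N - i) fun r => f (.node () l r))
      = (growthSum i (fun l => growthSum (N - i) (fun r => f (.node () l r)) .nil) .nil)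
        / (i.factorial * (N - i).factorial) := by
    have : (fun l => treeMean (N - i) fun r => f (.node () l r)) = fun l =>
        ((N - i).factorial : R)⁻¹ * growthSum (N - i) (fun r => f (.node () l r)) .nil := by
      funext l; rw [treeMean, div_eq_inv_mul]
    rw [this, treeMean_mul, treeMean]; field_simp
  -- The binomial coefficient cancels the factorials of the two subtree sizes, so each split gets
  -- the same weight 1/(N + 1).
  rw [h5, Nat.cast_choose R hi']
  push_cast
  field_simp

end Mean

/-! ### An additive functional with local tolls -/

/-- The number of nodes whose left subtree has size `K - 1`, plus `b` times the number of nodes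
whose right subtree has size `K - 1`. -/
def childCount (K : ℕ) (b : ℝ) : BinaryTree Unit → ℝ
  | .nil => 0
  | .node _ l r => childCount K b l + childCount K b r +
      ((if l.numNodes + 1 = K then 1 else 0) + if r.numNodes + 1 = K then b else 0)

/-- The slope of the expectation of `childCount K b` as a function of the number of nodes. -/
noncomputable def slope (K : ℕ) (b : ℝ) : ℝ := (1 + b) / (K * (K + 1))

/-- The expectation of `childCount K b` at the random tree with `n` nodes. -/
noncomputable def centre (K : ℕ) (b : ℝ) (n : ℕ) : ℝ :=
  if K ≤ n then slope K b * (n + 1) else 0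

/-- The change of the expectation of `childCount K b` caused by splitting `N + 1` nodes into the
root, a left subtree of size `i` and a right subtree of size `N - i`. -/
noncomputable def splitToll (K : ℕ) (b : ℝ) (N i : ℕ) : ℝ :=
  centre K b i + centre K b (N - i) + ((if i + 1 = K then 1 else 0) + if N - i + 1 = K then b else 0)
    - centre K b (N + 1)

/-- The contribution to `splitToll` of one of the two subtrees. -/
noncomputable def bump (K : ℕ) (b a : ℝ) (i : ℕ) : ℝ :=
  if i < K then (if i + 1 = K then a else 0) - slope K b * (i + 1) else 0

/-- The distributional recursion at the root. It is stated for an arbitrary φ so that it serves the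
mean, the variance and the characteristic function. -/
lemma treeMean_childCount_succ {R : Type*} [Field R] [CharZero R] (K : ℕ) (b : ℝ) (N : ℕ)
    (φ : ℝ → R) :
    treeMean (N + 1) (fun x => φ (childCount K b x - centre K b (N + 1)))
      = (∑ i ∈ Finset.range (N + 1), treeMean i fun l => treeMean (N - i) fun r =>
          φ ((childCount K b l - centre K b i) + (childCount K b r - centre K b (N - i))
            + splitToll K b N i)) / (N + 1) := by
  rw [treeMean_succ]
  congr 1
  refine Finset.sum_congr rfl fun i _ => treeMean_congr i fun l hl => treeMean_congr _ fun r hr => ?_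
  congr 1
  simp only [childCount, splitToll, hl, hr]
  ring

/-- The affine function slope·(n + 1) is additive under a split, since (i + 1) + (N - i + 1) = N +
2. Only subtrees smaller than K, where `centre` is 0 instead, contribute a defect. -/
lemma splitToll_eq_bump {K : ℕ} (b : ℝ) {N i : ℕ} (hi : i ≤ N) (hK : K ≤ N + 1) :
    splitToll K b N i = bump K b 1 i + bump K b b (N - i) := by
  obtain ⟨j, rfl⟩ := Nat.exists_eq_add_of_le hi
  have hij : i + j - i = j := by omega
  simp only [splitToll, centre, bump, hij, if_pos hK]
  have h1 : (K ≤ i) ↔ ¬ (i < K) := by omega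
  have h2 : (K ≤ j) ↔ ¬ (j < K) := by omega
  have h3 : ¬ i < K → ¬ (i + 1 = K) := by omega
  have h4 : ¬ j < K → ¬ (j + 1 = K) := by omega
  by_cases hiK : i < K <;> by_cases hjK : j < K <;>
    simp only [h1, h2, hiK, hjK, not_true, not_false_eq_true, if_true, if_false] <;>
    push_cast <;> (try simp only [h3 hiK, if_false]) <;> (try simp only [h4 hjK, if_false]) <;> ring

lemma splitToll_eq_zero {K : ℕ} (b : ℝ) {N i : ℕ} (hi : i ≤ N) (hK : N + 1 < K) :
    splitToll K b N i = 0 := by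
  simp only [splitToll, centre]
  rw [if_neg (by omega), if_neg (by omega), if_neg (by omega), if_neg (by omega),
    if_neg (by omega)]
  ring

lemma sum_range_bump_comp {K n : ℕ} (b a : ℝ) (h : K ≤ n) (φ : ℝ → ℝ) (hφ : φ 0 = 0) :
    ∑ i ∈ Finset.range n, φ (bump K b a i) = ∑ i ∈ Finset.range K, φ (bump K b a i) := by
  symm
  refine Finset.sum_subset (Finset.range_subset_range.2 h) fun i _ hi => ?_
  rw [bump, if_neg (by simpa using hi), hφ]

lemma sum_range_succ_cast (n : ℕ) :
    ∑ i ∈ Finset.range n, ((i : ℝ) + 1) = n * (n + 1) / 2 := by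
  induction n with
  | zero => simp
  | succ n ih => rw [Finset.sum_range_succ, ih]; push_cast; ring

lemma sum_range_bump {K : ℕ} (hK : 1 ≤ K) (b a : ℝ) :
    ∑ i ∈ Finset.range K, bump K b a i = a - slope K b * (K * (K + 1) / 2) := by
  have h : ∀ i ∈ Finset.range K, bump K b a i
      = (if i = K - 1 then a else 0) - slope K b * (i + 1) := by
    intro i hi
    have hi' := Finset.mem_range.1 hi
    rw [bump, if_pos hi']
    congr 1
    exact if_congr (by omega) rfl rfl
  rw [Finset.sum_congr rfl h, Finset.sum_sub_distrib, ← Finset.mul_sum, sum_range_succ_cast,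
    Finset.sum_ite_eq', if_pos (Finset.mem_range.2 (by omega))]

/-! ### Estimates for the tolls. -/

section Tolls

variable {K : ℕ} {b : ℝ}

lemma slope_mul_sq (hK : 1 ≤ K) : slope K b * (K * (K + 1)) = 1 + b := by
  have : (K : ℝ) ≠ 0 := by positivity
  unfold slope
  field_simp

lemma slope_nonneg (hb : 0 ≤ b) : 0 ≤ slope K b := by
  unfold slope; positivity

lemma slope_mul_le (hb1 : b ≤ 1) (hK : 1 ≤ K) : slope K b * K * (K + 1) ≤ 2 := by
  have := slope_mul_sq (b := b) hK
  nlinarith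

/-- The value of `slope` is chosen for this: the indicators add up to 1 + b, and the linear parts to
slope·K(K + 1). -/
lemma sum_splitToll (hK : 1 ≤ K) (N : ℕ) :
    ∑ i ∈ Finset.range (N + 1), splitToll K b N i = 0 := by
  rcases le_or_gt K (N + 1) with h | h
  · rw [Finset.sum_congr rfl fun i hi =>
      splitToll_eq_bump b (Nat.lt_succ_iff.1 (Finset.mem_range.1 hi)) h,
      Finset.sum_add_distrib, Finset.sum_flip fun j => bump K b b j]
    have h1 := sum_range_bump_comp b 1 h id rfl
    have h2 := sum_range_bump_comp b b h id rfl
    simp only [id] at h1 h2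
    rw [h1, h2, sum_range_bump hK, sum_range_bump hK]
    have := slope_mul_sq (b := b) hK
    linarith
  · exact Finset.sum_eq_zero fun i hi =>
      splitToll_eq_zero b (Nat.lt_succ_iff.1 (Finset.mem_range.1 hi)) h

lemma slope_mul_succ_le (hb : 0 ≤ b) (hb1 : b ≤ 1) (hK : 1 ≤ K) {i : ℕ} (hi : i < K) :
    slope K b * (i + 1) ≤ 2 / (K + 1) := by
  have h1 : ((i : ℝ) + 1) ≤ K := by exact_mod_cast hi
  rw [le_div_iff₀ (by positivity)]
  calc slope K b * (i + 1) * (K + 1) ≤ slope K b * K * (K + 1) := by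
        have := slope_nonneg (K := K) hb
        gcongr
    _ ≤ 2 := slope_mul_le hb1 hK

lemma abs_bump_le (hb : 0 ≤ b) (hb1 : b ≤ 1) (hK : 1 ≤ K) {a : ℝ} (ha : 0 ≤ a) (ha1 : a ≤ 1)
    (i : ℕ) : |bump K b a i| ≤ 1 := by
  unfold bump
  split_ifs with h h'
  on_goal 3 => simp
  all_goals
    have h1 := slope_mul_succ_le hb hb1 hK h
    have h2 : (2 : ℝ) / (K + 1) ≤ 1 := by
      rw [div_le_one (by positivity)]
      have : (1 : ℝ) ≤ K := by exact_mod_cast hK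
      linarith
    have h3 : 0 ≤ slope K b * ((i : ℝ) + 1) := mul_nonneg (slope_nonneg hb) (by positivity)
    rw [abs_le]; constructor <;> linarith

/-- A bump is a spike of height at most 1 at K - 1 minus K values of size at most 2/(K + 1), so its
sum of squares is bounded uniformly in K. -/
lemma sum_bump_sq_le (hb : 0 ≤ b) (hb1 : b ≤ 1) (hK : 1 ≤ K) {a : ℝ} (ha : 0 ≤ a) (ha1 : a ≤ 1) :
    ∑ i ∈ Finset.range K, bump K b a i ^ 2 ≤ 4 := by
  have h : ∀ i ∈ Finset.range K, bump K b a i ^ 2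
      ≤ (if i = K - 1 then 2 else 0) + 2 * (2 / ((K : ℝ) + 1)) ^ 2 := by
    intro i hi
    have hi' := Finset.mem_range.1 hi
    have h1 := slope_mul_succ_le hb hb1 hK hi'
    have h3 : 0 ≤ slope K b * ((i : ℝ) + 1) := mul_nonneg (slope_nonneg hb) (by positivity)
    have h4 := pow_le_pow_left₀ h3 h1 2
    rw [bump, if_pos hi']
    split_ifs
    · nlinarith [sq_nonneg (a + slope K b * ((i : ℝ) + 1))]
    · omega
    · omega
    · nlinarith
  refine (Finset.sum_le_sum h).trans ?_
  rw [Finset.sum_add_distrib, Finset.sum_ite_eq', if_pos (Finset.mem_range.2 (by omega)),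
    Finset.sum_const, Finset.card_range, nsmul_eq_mul]
  have h5 : (K : ℝ) * (2 * (2 / ((K : ℝ) + 1)) ^ 2) ≤ 2 := by
    rw [div_pow, ← mul_div_assoc, ← mul_div_assoc, div_le_iff₀ (by positivity)]
    nlinarith [sq_nonneg ((K : ℝ) - 1)]
  linarith

lemma abs_splitToll_le (hb : 0 ≤ b) (hb1 : b ≤ 1) (hK : 1 ≤ K) {N i : ℕ} (hi : i ≤ N) :
    |splitToll K b N i| ≤ 2 := by
  rcases le_or_gt K (N + 1) with h | h
  · rw [splitToll_eq_bump b hi h]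
    have h1 := abs_bump_le hb hb1 hK zero_le_one le_rfl i
    have h2 := abs_bump_le hb hb1 hK hb hb1 (N - i)
    exact (abs_add_le _ _).trans (by linarith)
  · rw [splitToll_eq_zero b hi h]; simp

lemma sum_splitToll_sq_le (hb : 0 ≤ b) (hb1 : b ≤ 1) (hK : 1 ≤ K) (N : ℕ) :
    ∑ i ∈ Finset.range (N + 1), splitToll K b N i ^ 2 ≤ 16 := by
  rcases le_or_gt K (N + 1) with h | h
  · have h1 := sum_range_bump_comp b 1 h (fun x => x ^ 2) (by simp)
    have h2 := sum_range_bump_comp b b h (fun x => x ^ 2) (by simp)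
    calc ∑ i ∈ Finset.range (N + 1), splitToll K b N i ^ 2
        ≤ ∑ i ∈ Finset.range (N + 1), (2 * bump K b 1 i ^ 2 + 2 * bump K b b (N - i) ^ 2) := by
          refine Finset.sum_le_sum fun i hi => ?_
          rw [splitToll_eq_bump b (Nat.lt_succ_iff.1 (Finset.mem_range.1 hi)) h]
          nlinarith [sq_nonneg (bump K b 1 i - bump K b b (N - i))]
      _ ≤ 16 := by
          rw [Finset.sum_add_distrib, Finset.sum_flip fun j => 2 * bump K b b j ^ 2,
            ← Finset.mul_sum, ← Finset.mul_sum, h1, h2]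
          linarith [sum_bump_sq_le hb hb1 hK zero_le_one le_rfl, sum_bump_sq_le hb hb1 hK hb hb1]
  · rw [Finset.sum_eq_zero fun i hi => by
      rw [splitToll_eq_zero b (Nat.lt_succ_iff.1 (Finset.mem_range.1 hi)) h]; simp]
    norm_num

/-- For 2K ≤ N + 1 the two subtrees cannot both be smaller than K, so the cross terms vanish and the
sum no longer depends on N. -/
lemma sum_splitToll_sq_eq (hK : 1 ≤ K) {N : ℕ} (hN : 2 * K ≤ N + 1) :
    ∑ i ∈ Finset.range (N + 1), splitToll K b N i ^ 2
      = ∑ i ∈ Finset.range K, bump K b 1 i ^ 2 + ∑ i ∈ Finset.range K, bump K b b i ^ 2 := by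
  have h : K ≤ N + 1 := by omega
  have h1 := sum_range_bump_comp b 1 h (fun x => x ^ 2) (by simp)
  have h2 := sum_range_bump_comp b b h (fun x => x ^ 2) (by simp)
  rw [← h1, ← h2, ← Finset.sum_flip fun j => bump K b b j ^ 2, ← Finset.sum_add_distrib]
  refine Finset.sum_congr rfl fun i hi => ?_
  have hi' := Nat.lt_succ_iff.1 (Finset.mem_range.1 hi)
  rw [splitToll_eq_bump b hi' h]
  have : bump K b 1 i * bump K b b (N - i) = 0 := by
    rcases lt_or_ge i K with h3 | h3
    · rw [show bump K b b (N - i) = 0 by rw [bump, if_neg (by omega)], mul_zero]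
    · rw [show bump K b 1 i = 0 by rw [bump, if_neg (by omega)], zero_mul]
  linear_combination 2 * this

/-- The spike at K - 1 alone suffices: its height is 1 - (1 + b)/(K + 1) ≥ 1/3. The condition 1 + b
≤ K rules out K = b = 1, where `childCount` counts all empty places and is deterministic. -/
lemma le_sum_splitToll_sq (hbK : 1 + b ≤ K) (hb1 : b ≤ 1) (hK : 1 ≤ K) {N : ℕ}
    (hN : 2 * K ≤ N + 1) :
    1 / 9 ≤ ∑ i ∈ Finset.range (N + 1), splitToll K b N i ^ 2 := by
  rw [sum_splitToll_sq_eq hK hN]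
  have h1 : bump K b 1 (K - 1) ^ 2 ≤ ∑ i ∈ Finset.range K, bump K b 1 i ^ 2 :=
    Finset.single_le_sum (f := fun i => bump K b 1 i ^ 2) (fun i _ => sq_nonneg _)
      (Finset.mem_range.2 (by omega))
  have h2 : 0 ≤ ∑ i ∈ Finset.range K, bump K b b i ^ 2 :=
    Finset.sum_nonneg fun i _ => sq_nonneg _
  have h3 : 1 / 3 ≤ bump K b 1 (K - 1) := by
    have hc : ((K - 1 : ℕ) : ℝ) + 1 = K := by
      have : ((K - 1 + 1 : ℕ) : ℝ) = K := by rw [Nat.sub_add_cancel hK]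
      push_cast at this; exact this
    rw [bump, if_pos (by omega), if_pos (by omega), hc]
    have h4 := slope_mul_sq (b := b) hK
    have hKr : (1 : ℝ) ≤ K := by exact_mod_cast hK
    have h5 : slope K b * K * (K + 1) ≤ 2 / 3 * (K + 1) := by
      rw [mul_assoc, h4]
      rcases hK.eq_or_lt with h | h
      · subst h; push_cast at hbK ⊢; linarith
      · have : (2 : ℝ) ≤ K := by exact_mod_cast h
        linarith
    have := le_of_mul_le_mul_right h5 (by positivity)
    linarith
  nlinarith

end Tolls

/-! ### Comparison for recursions of quicksort type -/

lemma sum_range_ite_affine {K n : ℕ} (a c : ℝ) (h : K ≤ n) :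
    ∑ i ∈ Finset.range n, (if K ≤ i then a * (i + 1) - c else 0)
      = a * (n * (n + 1) - K * (K + 1)) / 2 - c * (n - K) := by
  induction n, h using Nat.le_induction with
  | base =>
    rw [Finset.sum_eq_zero fun i hi => if_neg (by simpa using hi)]; ring
  | succ n hn ih => rw [Finset.sum_range_succ, ih, if_pos hn]; push_cast; ring

/-- The sequence a(n + 1) solves the homogeneous recursion, and the constant -c absorbs the source
c(N + 1). Since u is nonpositive below K, the sum gains the deficit aK(K + 1), which pays for q +
2cK; hence a slope of order K⁻² is enough. -/
lemma le_affine_of_recursion {K : ℕ} {u : ℕ → ℝ} {a c q : ℝ}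
    (h0 : ∀ n < K, u n ≤ 0)
    (hu : ∀ N, K ≤ N + 1 →
      (N + 1) * u (N + 1) ≤ 2 * ∑ i ∈ Finset.range (N + 1), u i + q + c * (N + 1))
    (ha : q + 2 * c * K ≤ a * (K * (K + 1))) (hK : 1 ≤ K) (n : ℕ) (hn : K ≤ n) :
    u n ≤ a * (n + 1) - c := by
  induction n using Nat.strong_induction_on with
  | _ n ih =>
    obtain ⟨N, rfl⟩ : ∃ N, n = N + 1 := ⟨n - 1, by omega⟩
    have h1 : ∑ i ∈ Finset.range (N + 1), u i
        ≤ ∑ i ∈ Finset.range (N + 1), (if K ≤ i then a * (i + 1) - c else 0) := by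
      refine Finset.sum_le_sum fun i hi => ?_
      split_ifs with hiK
      · exact ih i (Finset.mem_range.1 hi) hiK
      · exact h0 i (by omega)
    rw [sum_range_ite_affine a c hn] at h1
    have h2 := hu N hn
    have hpos : (0 : ℝ) < N + 1 := by positivity
    refine le_of_mul_le_mul_left ?_ hpos
    push_cast at h1 h2 ⊢
    nlinarith

/-! ### Mean and variance -/

/-- The variance of `childCount K b` at the random tree with `n` nodes. -/
noncomputable def treeVariance (K : ℕ) (b : ℝ) (n : ℕ) : ℝ :=
  treeMean n fun x => (childCount K b x - centre K b n) ^ 2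

section Moments

variable {K : ℕ} {b : ℝ}

/-- The tolls of all splits sum to zero, so centring by `centre` is preserved by the root recursion.
-/
lemma treeMean_childCount_sub_centre (hK : 1 ≤ K) (n : ℕ) :
    treeMean n (fun x => childCount K b x - centre K b n) = 0 := by
  induction n using Nat.strong_induction_on with
  | _ n ih =>
    cases n with
    | zero => rw [treeMean_zero, childCount, centre, if_neg (by omega), sub_zero]
    | succ N =>
      rw [treeMean_childCount_succ K b N fun x => x]
      rw [Finset.sum_congr rfl fun i hi => ?_, sum_splitToll (b := b) hK N, zero_div]
      have hi' := Finset.mem_range.1 hi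
      simp only [treeMean_add, treeMean_const, ih i hi', ih (N - i) (by omega), zero_add, add_zero]

lemma treeVariance_zero (hK : 1 ≤ K) : treeVariance K b 0 = 0 := by
  rw [treeVariance, treeMean_zero, childCount, centre, if_neg (by omega)]; norm_num

lemma treeMean_add_add_sq {i j : ℕ} {f g : BinaryTree Unit → ℝ} (hf : treeMean i f = 0)
    (hg : treeMean j g = 0) (d : ℝ) :
    treeMean i (fun l => treeMean j fun r => (f l + g r + d) ^ 2)
      = treeMean i (fun l => f l ^ 2) + treeMean j (fun r => g r ^ 2) + d ^ 2 := by
  have h1 : ∀ l, treeMean j (fun r => (f l + g r + d) ^ 2)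
      = (f l ^ 2 + 2 * d * f l) + (treeMean j (fun r => g r ^ 2) + d ^ 2) := by
    intro l
    rw [treeMean_congr (g := fun r => (g r ^ 2 + (2 * (f l + d)) * g r) + (f l + d) ^ 2) j
      fun r _ => by ring, treeMean_add, treeMean_add, treeMean_mul, hg, treeMean_const]
    ring
  simp only [h1]
  rw [treeMean_add, treeMean_add, treeMean_mul, hf, treeMean_const]
  ring

/-- Given the split, the two subtrees are independent and centred, so all mixed terms of the square
drop out. -/
lemma treeVariance_succ (hK : 1 ≤ K) (N : ℕ) :
    (N + 1) * treeVariance K b (N + 1)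
      = 2 * ∑ i ∈ Finset.range (N + 1), treeVariance K b i
        + ∑ i ∈ Finset.range (N + 1), splitToll K b N i ^ 2 := by
  have h1 : ((N : ℝ) + 1) ≠ 0 := by positivity
  rw [treeVariance, treeMean_childCount_succ K b N fun x => x ^ 2, mul_div_cancel₀ _ h1,
    Finset.sum_congr rfl fun i _ => treeMean_add_add_sq (treeMean_childCount_sub_centre hK i)
      (treeMean_childCount_sub_centre hK (N - i)) _,
    Finset.sum_add_distrib, Finset.sum_add_distrib,
    Finset.sum_flip fun j => treeMean j fun r => (childCount K b r - centre K b j) ^ 2]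
  simp only [treeVariance]
  ring

lemma treeVariance_nonneg (hK : 1 ≤ K) (n : ℕ) : 0 ≤ treeVariance K b n := by
  induction n using Nat.strong_induction_on with
  | _ n ih =>
    cases n with
    | zero => rw [treeVariance_zero hK]
    | succ N =>
      have h := treeVariance_succ (b := b) hK N
      have h1 : 0 ≤ ∑ i ∈ Finset.range (N + 1), treeVariance K b i :=
        Finset.sum_nonneg fun i hi => ih i (Finset.mem_range.1 hi)
      have h2 : 0 ≤ ∑ i ∈ Finset.range (N + 1), splitToll K b N i ^ 2 :=
        Finset.sum_nonneg fun i _ => sq_nonneg _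
      have : 0 ≤ ((N : ℝ) + 1) * treeVariance K b (N + 1) := by rw [h]; positivity
      exact nonneg_of_mul_nonneg_right this (by positivity)

lemma treeVariance_eq_zero (hK : 1 ≤ K) (n : ℕ) (hn : n < K) : treeVariance K b n = 0 := by
  induction n using Nat.strong_induction_on with
  | _ n ih =>
    cases n with
    | zero => rw [treeVariance_zero hK]
    | succ N =>
      have h := treeVariance_succ (b := b) hK N
      rw [Finset.sum_eq_zero fun i hi => ih i (Finset.mem_range.1 hi)
          ((Finset.mem_range.1 hi).trans hn),
        Finset.sum_eq_zero fun i hi => by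
          rw [splitToll_eq_zero b (Nat.lt_succ_iff.1 (Finset.mem_range.1 hi)) hn]; simp] at h
      have h1 : ((N : ℝ) + 1) ≠ 0 := by positivity
      simpa [h1] using h

lemma treeVariance_le (hb : 0 ≤ b) (hb1 : b ≤ 1) (hK : 1 ≤ K) (n : ℕ) :
    treeVariance K b n ≤ 16 / (K * (K + 1)) * (n + 1) := by
  rcases lt_or_ge n K with h | h
  · rw [treeVariance_eq_zero hK n h]; positivity
  · have hKr : (K : ℝ) ≠ 0 := by positivity
    have := le_affine_of_recursion (u := treeVariance K b) (a := 16 / (K * (K + 1))) (c := 0)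
      (q := 16) (fun n hn => (treeVariance_eq_zero hK n hn).le) (fun N _ => by
        rw [treeVariance_succ hK]
        linarith [sum_splitToll_sq_le hb hb1 hK N]) (by field_simp; simp) hK n h
    simpa using this

/-- The ratio of the variance to `n + 1`, for large `n`. -/
noncomputable def varianceSlope (K : ℕ) (b : ℝ) : ℝ := treeVariance K b (2 * K) / (2 * K + 1)

/-- Subtracting consecutive instances of the recursion, whose toll sums agree from 2K on, leaves (n
+ 1)V(n + 1) = (n + 2)V(n). -/
lemma treeVariance_eq (hK : 1 ≤ K) (n : ℕ) (hn : 2 * K ≤ n) :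
    treeVariance K b n = varianceSlope K b * (n + 1) := by
  induction n, hn using Nat.le_induction with
  | base =>
    have : (2 * (K : ℝ) + 1) ≠ 0 := by positivity
    rw [varianceSlope]; push_cast; field_simp
  | succ n hn ih =>
    obtain ⟨N, rfl⟩ : ∃ N, n = N + 1 := ⟨n - 1, by omega⟩
    have h1 := treeVariance_succ (b := b) hK N
    have h2 := treeVariance_succ (b := b) hK (N + 1)
    rw [Finset.sum_range_succ, sum_splitToll_sq_eq (b := b) hK (by omega)] at h2
    rw [sum_splitToll_sq_eq (b := b) hK hn] at h1
    have h3 : ((N : ℝ) + 2) ≠ 0 := by positivity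
    push_cast at h1 h2 ih ⊢
    apply mul_left_cancel₀ h3
    linear_combination h2 - h1 + (N + 3) * ih

/-- The recursion at n = 2K gives 2K·V(2K) ≥ 1/9, and 2K(2K + 1) ≤ 6K² yields the constant 54 = 9·6.
-/
lemma le_varianceSlope (hbK : 1 + b ≤ K) (hb1 : b ≤ 1) (hK : 1 ≤ K) :
    1 / (54 * (K : ℝ) ^ 2) ≤ varianceSlope K b := by
  obtain ⟨N, hN⟩ : ∃ N, 2 * K = N + 1 := ⟨2 * K - 1, by omega⟩
  have h := treeVariance_succ (b := b) hK N
  have h1 : 0 ≤ ∑ i ∈ Finset.range (N + 1), treeVariance K b i :=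
    Finset.sum_nonneg fun i _ => treeVariance_nonneg hK i
  have h2 := le_sum_splitToll_sq hbK hb1 hK hN.le
  rw [← hN] at h
  have hN' : (2 * K : ℝ) = N + 1 := by exact_mod_cast hN
  rw [← hN'] at h
  have hKr : (1 : ℝ) ≤ K := by exact_mod_cast hK
  rw [varianceSlope, le_div_iff₀ (by positivity), div_mul_eq_mul_div,
    div_le_iff₀ (by positivity)]
  have h4 : 1 / 9 ≤ 2 * K * treeVariance K b (2 * K) := by
    rw [← hN] at h1 h2
    linarith
  nlinarith

/-- From 2K on the difference is zero; below, both quantities lie between 0 and 16/(K(K + 1))·2K ≤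
32/K. -/
lemma abs_treeVariance_sub_le (hb : 0 ≤ b) (hb1 : b ≤ 1) (hK : 1 ≤ K) (n : ℕ) :
    |treeVariance K b n - varianceSlope K b * (n + 1)| ≤ 32 / K := by
  have hKr : (0 : ℝ) < K := by positivity
  rcases le_or_gt (2 * K) n with h | h
  · rw [treeVariance_eq hK n h, sub_self, abs_zero]; positivity
  · have hn : (n : ℝ) + 1 ≤ 2 * K := by exact_mod_cast h
    have key : 16 / ((K : ℝ) * (K + 1)) * (n + 1) ≤ 32 / K := by
      rw [div_mul_eq_mul_div, div_le_div_iff₀ (by positivity) hKr]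
      nlinarith [mul_le_mul_of_nonneg_right hn hKr.le]
    have h1 := treeVariance_le hb hb1 hK n
    have h2 := treeVariance_nonneg (b := b) hK n
    have h3 : varianceSlope K b * (n + 1) ≤ 16 / (K * (K + 1)) * (n + 1) := by
      have := treeVariance_le hb hb1 hK (2 * K)
      gcongr
      rw [varianceSlope, div_le_iff₀ (by positivity)]
      push_cast at this
      exact this
    have h4 : 0 ≤ varianceSlope K b * (n + 1) := by
      have := treeVariance_nonneg (b := b) hK (2 * K)
      unfold varianceSlope; positivity
    rw [abs_le]; constructor <;> linarith

/-- The linear approximation is additive under a split, so only the three errors of size 32/K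
remain. -/
lemma abs_treeVariance_split_le (hb : 0 ≤ b) (hb1 : b ≤ 1) (hK : 1 ≤ K) {N i : ℕ} (hi : i ≤ N) :
    |treeVariance K b i + treeVariance K b (N - i) - treeVariance K b (N + 1)| ≤ 96 / K := by
  have h1 := abs_le.1 (abs_treeVariance_sub_le hb hb1 hK i)
  have h2 := abs_le.1 (abs_treeVariance_sub_le hb hb1 hK (N - i))
  have h3 := abs_le.1 (abs_treeVariance_sub_le hb hb1 hK (N + 1))
  have hc : ((N - i : ℕ) : ℝ) = N - i := by push_cast [hi]; ring
  have h96 : (96 : ℝ) / K = 32 / K + 32 / K + 32 / K := by ring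
  rw [hc] at h2
  push_cast at h3
  have e1 : varianceSlope K b * (i + 1) + varianceSlope K b * ((N : ℝ) - i + 1)
      = varianceSlope K b * ((N : ℝ) + 1 + 1) := by ring
  rw [abs_le, h96]; constructor <;> linarith

end Moments

/-! ### Characteristic functions -/

/-- The characteristic function at `s` of the centred `childCount K b`. -/
noncomputable def centredChar (K : ℕ) (b s : ℝ) (n : ℕ) : ℂ :=
  treeMean n fun x => Complex.exp ((s * (childCount K b x - centre K b n) : ℝ) * Complex.I)

/-- The characteristic function at `s` of the centred normal distribution with the variance of
`childCount K b`. -/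
noncomputable def gaussChar (K : ℕ) (b s : ℝ) (n : ℕ) : ℂ :=
  Complex.exp ((-(s ^ 2 * treeVariance K b n / 2) : ℝ))

/-- Second-order Taylor expansion: the square of the exponent contributes -s²d²/2 at order s², and
everything else is of order |s|³. The bound on s makes the exponent at most 3|s|. Keeping d² and v²
on the right allows summation over splits. -/
lemma norm_exp_sub_le {s d v : ℝ} (hs : |s| ≤ 1 / 100) (hd : |d| ≤ 2) (hv : |v| ≤ 96) :
    ‖Complex.exp ((s * d : ℝ) * Complex.I - (s ^ 2 * v / 2 : ℝ)) - 1
      - ((s * d : ℝ) * Complex.I - (s ^ 2 * v / 2 : ℝ) - (s ^ 2 * d ^ 2 / 2 : ℝ))‖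
      ≤ 3 * |s| ^ 3 * (d ^ 2 + v ^ 2) := by
  set z : ℂ := (s * d : ℝ) * Complex.I - (s ^ 2 * v / 2 : ℝ) with hz
  have hs0 := abs_nonneg s
  have hnorm : ‖z‖ ≤ |s| * |d| + |s| ^ 2 * |v| / 2 := by
    refine (norm_sub_le _ _).trans ?_
    rw [norm_mul, Complex.norm_I, mul_one, Complex.norm_real, Complex.norm_real, Real.norm_eq_abs,
      Real.norm_eq_abs, abs_mul, abs_div, abs_mul, abs_pow, abs_two]
  have hz3 : ‖z‖ ≤ 3 * |s| := by
    have h1 : |s| * |d| ≤ |s| * 2 := by gcongr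
    have h2 : |s| ^ 2 * |v| ≤ |s| * (1 / 100) * 96 := by
      rw [sq]; gcongr
    linarith
  have hz1 : ‖z‖ ≤ 1 := by linarith
  have hsq : ‖z‖ ^ 2 ≤ 2 * |s| ^ 2 * (d ^ 2 + v ^ 2) := by
    have h1 : ‖z‖ ^ 2 ≤ (|s| * |d| + |s| ^ 2 * |v| / 2) ^ 2 := by gcongr
    have h2 : |s| ^ 2 ≤ 1 := by nlinarith
    have h3 : (|s| * |d| + |s| ^ 2 * |v| / 2) ^ 2
        ≤ 2 * (|s| ^ 2 * |d| ^ 2 + |s| ^ 2 * |s| ^ 2 * |v| ^ 2 / 4) := by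
      nlinarith [sq_nonneg (|s| * |d| - |s| ^ 2 * |v| / 2)]
    have h4 : |s| ^ 2 * |s| ^ 2 * |v| ^ 2 ≤ |s| ^ 2 * 1 * |v| ^ 2 := by gcongr
    rw [sq_abs d, sq_abs v] at *
    nlinarith [mul_nonneg (sq_nonneg |s|) (sq_nonneg v)]
  have hexp := Complex.exp_bound hz1 (n := 3) (by norm_num)
  have hsum : ∑ m ∈ Finset.range 3, z ^ m / (m.factorial : ℂ) = 1 + z + z ^ 2 / 2 := by
    simp [Finset.sum_range_succ, Nat.factorial]
  rw [hsum] at hexp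
  have hsplit : Complex.exp z - 1 - (z - (s ^ 2 * d ^ 2 / 2 : ℝ))
      = (Complex.exp z - (1 + z + z ^ 2 / 2))
        + ((s ^ 4 * v ^ 2 / 8 : ℝ) - (s ^ 3 * d * v / 2 : ℝ) * Complex.I) := by
    have hI := Complex.I_sq
    rw [hz]; push_cast
    linear_combination ((s : ℂ) ^ 2 * d ^ 2 / 2) * hI
  rw [hsplit]
  refine (norm_add_le _ _).trans ?_
  have h5 : ‖(((s ^ 4 * v ^ 2 / 8 : ℝ) : ℂ) - (s ^ 3 * d * v / 2 : ℝ) * Complex.I)‖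
      ≤ |s| ^ 3 * (d ^ 2 + v ^ 2) := by
    refine (norm_sub_le _ _).trans ?_
    rw [norm_mul, Complex.norm_I, mul_one, Complex.norm_real, Complex.norm_real, Real.norm_eq_abs,
      Real.norm_eq_abs, abs_div, abs_mul, abs_div, abs_mul, abs_mul, abs_pow, abs_pow, abs_pow,
      abs_two, sq_abs, show |(8 : ℝ)| = 8 by norm_num]
    have h6 : |s| ^ 4 * v ^ 2 ≤ |s| ^ 3 * v ^ 2 := by
      have : |s| ^ 4 ≤ |s| ^ 3 := pow_le_pow_of_le_one hs0 (by linarith) (by norm_num)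
      gcongr
    have h7 : |s| ^ 3 * |d| * |v| ≤ |s| ^ 3 * ((d ^ 2 + v ^ 2) / 2) := by
      rw [mul_assoc]; gcongr
      rw [← sq_abs d, ← sq_abs v]
      nlinarith [sq_nonneg (|d| - |v|)]
    nlinarith [mul_nonneg (pow_nonneg hs0 3) (sq_nonneg d),
      mul_nonneg (pow_nonneg hs0 3) (sq_nonneg v)]
  have h8 : ‖z‖ ^ 3 * ((Nat.succ 3 : ℕ) * ((Nat.factorial 3 : ℕ) * (3 : ℕ) : ℝ)⁻¹)
      ≤ 2 * (|s| ^ 3 * (d ^ 2 + v ^ 2)) := by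
    have h9 : ‖z‖ ^ 3 ≤ 3 * |s| * (2 * |s| ^ 2 * (d ^ 2 + v ^ 2)) := by
      rw [pow_succ' ‖z‖ 2]; gcongr
    have h10 : 0 ≤ |s| ^ 3 * (d ^ 2 + v ^ 2) := by positivity
    have h11 : 3 * |s| * (2 * |s| ^ 2 * (d ^ 2 + v ^ 2)) = 6 * (|s| ^ 3 * (d ^ 2 + v ^ 2)) := by ring
    rw [h11] at h9
    have h12 : ((Nat.succ 3 : ℕ) * ((Nat.factorial 3 : ℕ) * (3 : ℕ) : ℝ)⁻¹) = 2 / 9 := by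
      norm_num [Nat.factorial]
    rw [h12]
    linarith
  linarith [hexp.trans h8]

section Bounds

variable {K : ℕ} {b s : ℝ}

lemma centredChar_zero (hK : 1 ≤ K) : centredChar K b s 0 = 1 := by
  rw [centredChar, treeMean_zero, childCount, centre, if_neg (by omega)]; simp

lemma centredChar_succ (N : ℕ) :
    (N + 1) * centredChar K b s (N + 1) = ∑ i ∈ Finset.range (N + 1),
      centredChar K b s i * centredChar K b s (N - i) *
        Complex.exp ((s * splitToll K b N i : ℝ) * Complex.I) := by
  have h1 : ((N : ℂ) + 1) ≠ 0 := by exact_mod_cast N.succ_ne_zero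
  rw [centredChar, treeMean_childCount_succ K b N fun x => Complex.exp ((s * x : ℝ) * Complex.I),
    mul_div_cancel₀ _ h1]
  refine Finset.sum_congr rfl fun i _ => ?_
  have h2 : ∀ x y d : ℝ, Complex.exp ((s * (x + y + d) : ℝ) * Complex.I)
      = Complex.exp ((s * d : ℝ) * Complex.I) * Complex.exp ((s * x : ℝ) * Complex.I) *
        Complex.exp ((s * y : ℝ) * Complex.I) := by
    intro x y d
    rw [← Complex.exp_add, ← Complex.exp_add]
    congr 1; push_cast; ring
  simp only [h2, treeMean_mul]
  have h3 : ∀ l : BinaryTree Unit,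
      Complex.exp ((s * splitToll K b N i : ℝ) * Complex.I) *
        Complex.exp ((s * (childCount K b l - centre K b i) : ℝ) * Complex.I) *
        treeMean (N - i) (fun r => Complex.exp
          ((s * (childCount K b r - centre K b (N - i)) : ℝ) * Complex.I))
      = (Complex.exp ((s * splitToll K b N i : ℝ) * Complex.I) *
        treeMean (N - i) (fun r => Complex.exp
          ((s * (childCount K b r - centre K b (N - i)) : ℝ) * Complex.I))) *
        Complex.exp ((s * (childCount K b l - centre K b i) : ℝ) * Complex.I) := fun l => by ring
  simp only [h3, treeMean_mul, centredChar]
  ring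

/-- Since `treeMean` is an algebraic sum and not an integral, the bound is read off from the
recursion. -/
lemma norm_centredChar_le (hK : 1 ≤ K) (n : ℕ) : ‖centredChar K b s n‖ ≤ 1 := by
  induction n using Nat.strong_induction_on with
  | _ n ih =>
    cases n with
    | zero => rw [centredChar_zero hK]; simp
    | succ N =>
      have h : ‖((N : ℂ) + 1) * centredChar K b s (N + 1)‖ ≤ N + 1 := by
        rw [centredChar_succ]
        calc _ ≤ ∑ i ∈ Finset.range (N + 1), (1 : ℝ) := by
              refine norm_sum_le_of_le _ fun i hi => ?_
              rw [norm_mul, norm_mul, Complex.norm_exp_ofReal_mul_I, mul_one]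
              exact mul_le_one₀ (ih i (Finset.mem_range.1 hi)) (norm_nonneg _)
                (ih (N - i) (by omega))
          _ = N + 1 := by simp
      have h1 : ‖(N : ℂ) + 1‖ = N + 1 := by
        rw [← Nat.cast_succ, Complex.norm_natCast]; push_cast; rfl
      rw [norm_mul, h1] at h
      have h2 : (0 : ℝ) < N + 1 := by positivity
      nlinarith

lemma centredChar_eq_one (hK : 1 ≤ K) (n : ℕ) (hn : n < K) : centredChar K b s n = 1 := by
  induction n using Nat.strong_induction_on with
  | _ n ih =>
    cases n with
    | zero => rw [centredChar_zero hK]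
    | succ N =>
      have h1 : ((N : ℂ) + 1) ≠ 0 := by exact_mod_cast N.succ_ne_zero
      apply mul_left_cancel₀ h1
      rw [centredChar_succ, Finset.sum_congr rfl fun i hi => ?_, Finset.sum_const,
        Finset.card_range, nsmul_one]
      · push_cast; ring
      · have hi' := Finset.mem_range.1 hi
        rw [ih i hi' (by omega), ih (N - i) (by omega) (by omega),
          splitToll_eq_zero b (by omega) hn]
        simp

lemma norm_gaussChar_le (hK : 1 ≤ K) (n : ℕ) : ‖gaussChar K b s n‖ ≤ 1 := by
  rw [gaussChar, ← Complex.ofReal_exp, Complex.norm_real, Real.norm_eq_abs, Real.abs_exp,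
    Real.exp_le_one_iff]
  have := treeVariance_nonneg (b := b) hK n
  have : 0 ≤ s ^ 2 * treeVariance K b n / 2 := by positivity
  linarith

/-- Each summand equals the Gaussian value at N + 1 times exp(z) - 1, where z combines the toll and
the change of variance. Up to order s² these exponentials sum to zero, and the Taylor remainders are
controlled by the sums of d² and D². -/
lemma gaussChar_recursion (hb : 0 ≤ b) (hb1 : b ≤ 1) (hK : 1 ≤ K) (hs : |s| ≤ 1 / 100) (N : ℕ) :
    ‖∑ i ∈ Finset.range (N + 1), (gaussChar K b s i * gaussChar K b s (N - i) *
        Complex.exp ((s * splitToll K b N i : ℝ) * Complex.I) - gaussChar K b s (N + 1))‖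
      ≤ 48 * |s| ^ 3 + 27648 * |s| ^ 3 / K * (N + 1) := by
  set D : ℕ → ℝ := fun i => treeVariance K b i + treeVariance K b (N - i)
    - treeVariance K b (N + 1) with hD
  set d : ℕ → ℝ := fun i => splitToll K b N i with hd
  set z : ℕ → ℂ := fun i => (s * d i : ℝ) * Complex.I - (s ^ 2 * D i / 2 : ℝ) with hz
  have hKr : (1 : ℝ) ≤ K := by exact_mod_cast hK
  have hterm : ∀ i, gaussChar K b s i * gaussChar K b s (N - i) *
        Complex.exp ((s * splitToll K b N i : ℝ) * Complex.I) - gaussChar K b s (N + 1)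
      = gaussChar K b s (N + 1) * (Complex.exp (z i) - 1) := by
    intro i
    rw [mul_sub, mul_one]
    congr 1
    simp only [gaussChar, ← Complex.exp_add, hz, hD, hd]
    congr 1; push_cast; ring
  -- The imaginary part vanishes because the tolls sum to zero, the real part because the variance
  -- recursion makes the sum of D equal to minus the sum of d².
  have hsum0 : ∑ i ∈ Finset.range (N + 1), (z i - (s ^ 2 * d i ^ 2 / 2 : ℝ)) = 0 := by
    have h1 : ∑ i ∈ Finset.range (N + 1), d i = 0 := sum_splitToll hK N
    have h2 : ∑ i ∈ Finset.range (N + 1), D i = - ∑ i ∈ Finset.range (N + 1), d i ^ 2 := by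
      rw [hD, Finset.sum_sub_distrib, Finset.sum_add_distrib,
        Finset.sum_flip fun j => treeVariance K b j, Finset.sum_const, Finset.card_range,
        nsmul_eq_mul]
      have := treeVariance_succ (b := b) hK N
      push_cast
      rw [this]; ring
    have h3 : ∀ i, z i - (s ^ 2 * d i ^ 2 / 2 : ℝ)
        = ((s * d i : ℝ) : ℂ) * Complex.I - ((s ^ 2 / 2 * (D i + d i ^ 2) : ℝ) : ℂ) := by
      intro i; simp only [hz]; push_cast; ring
    simp only [h3]
    rw [Finset.sum_sub_distrib, ← Finset.sum_mul, ← Complex.ofReal_sum, ← Complex.ofReal_sum,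
      ← Finset.mul_sum, ← Finset.mul_sum, Finset.sum_add_distrib, h1, h2]
    simp
  simp only [hterm]
  rw [← Finset.mul_sum]
  have hrw : ∑ i ∈ Finset.range (N + 1), (Complex.exp (z i) - 1)
      = ∑ i ∈ Finset.range (N + 1),
        (Complex.exp (z i) - 1 - (z i - (s ^ 2 * d i ^ 2 / 2 : ℝ))) := by
    rw [Finset.sum_sub_distrib (f := fun i => Complex.exp (z i) - 1), hsum0, sub_zero]
  rw [hrw, norm_mul]
  have hmain : ‖∑ i ∈ Finset.range (N + 1),
        (Complex.exp (z i) - 1 - (z i - (s ^ 2 * d i ^ 2 / 2 : ℝ)))‖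
      ≤ ∑ i ∈ Finset.range (N + 1), (3 * |s| ^ 3 * d i ^ 2 + 3 * |s| ^ 3 * (9216 / K)) := by
    refine norm_sum_le_of_le _ fun i hi => ?_
    have hi' := Nat.lt_succ_iff.1 (Finset.mem_range.1 hi)
    have h1 : |D i| ≤ 96 / K := abs_treeVariance_split_le hb hb1 hK hi'
    have h96 : (96 : ℝ) / K ≤ 96 := div_le_self (by norm_num) hKr
    refine (norm_exp_sub_le hs (abs_splitToll_le hb hb1 hK hi') (h1.trans h96)).trans ?_
    -- One factor 1/K is kept: the error per split is then c = O(|s|³/K), for which the term 2cK in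
    -- the comparison lemma stays O(|s|³).
    have h2 : D i ^ 2 ≤ 9216 / K := by
      rw [← sq_abs, sq]
      calc |D i| * |D i| ≤ (96 / K) * 96 := by gcongr; exact h1.trans h96
        _ = 9216 / K := by ring
    rw [← mul_add]
    gcongr
  rw [Finset.sum_add_distrib, ← Finset.mul_sum, Finset.sum_const, Finset.card_range,
    nsmul_eq_mul] at hmain
  have h16 : ∑ i ∈ Finset.range (N + 1), d i ^ 2 ≤ 16 := sum_splitToll_sq_le hb hb1 hK N
  have hG := norm_gaussChar_le (b := b) (s := s) hK (N + 1)
  refine (mul_le_of_le_one_left (norm_nonneg _) hG).trans (hmain.trans ?_)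
  have : 3 * |s| ^ 3 * ∑ i ∈ Finset.range (N + 1), d i ^ 2 ≤ 3 * |s| ^ 3 * 16 := by gcongr
  push_cast
  refine (add_le_add_left this _).trans (le_of_eq ?_)
  ring

lemma norm_mul_sub_mul_le {x y u v : ℂ} (hy : ‖y‖ ≤ 1) (hu : ‖u‖ ≤ 1) :
    ‖x * y - u * v‖ ≤ ‖x - u‖ + ‖y - v‖ := by
  have : x * y - u * v = (x - u) * y + u * (y - v) := by ring
  rw [this]
  refine (norm_add_le _ _).trans ?_
  rw [norm_mul, norm_mul]
  exact add_le_add (mul_le_of_le_one_right (norm_nonneg _) hy)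
    (mul_le_of_le_one_left (norm_nonneg _) hu)

/-- All factors have modulus at most 1, so a difference of products is at most the sum of the
differences; reflecting i to N - i doubles one sum. The defect of the Gaussian recursion is the
source term. -/
lemma norm_centredChar_sub_gaussChar_succ_le (hb : 0 ≤ b) (hb1 : b ≤ 1) (hK : 1 ≤ K)
    (hs : |s| ≤ 1 / 100) (N : ℕ) :
    (N + 1) * ‖centredChar K b s (N + 1) - gaussChar K b s (N + 1)‖
      ≤ 2 * ∑ i ∈ Finset.range (N + 1), ‖centredChar K b s i - gaussChar K b s i‖
        + 48 * |s| ^ 3 + 27648 * |s| ^ 3 / K * (N + 1) := by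
  set A := centredChar K b s
  set G := gaussChar K b s
  set E : ℕ → ℂ := fun i => Complex.exp ((s * splitToll K b N i : ℝ) * Complex.I) with hE
  have h1 : ((N : ℂ) + 1) * (A (N + 1) - G (N + 1))
      = ∑ i ∈ Finset.range (N + 1), (A i * A (N - i) - G i * G (N - i)) * E i
        + ∑ i ∈ Finset.range (N + 1), (G i * G (N - i) * E i - G (N + 1)) := by
    rw [mul_sub, centredChar_succ, ← Finset.sum_add_distrib]
    have : ((N : ℂ) + 1) * G (N + 1) = ∑ i ∈ Finset.range (N + 1), G (N + 1) := by
      rw [Finset.sum_const, Finset.card_range, nsmul_eq_mul]; push_cast; rfl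
    rw [this, ← Finset.sum_sub_distrib]
    refine Finset.sum_congr rfl fun i _ => ?_
    ring
  have h2 : ‖(N : ℂ) + 1‖ = N + 1 := by
    rw [← Nat.cast_succ, Complex.norm_natCast]; push_cast; rfl
  have h3 : ‖∑ i ∈ Finset.range (N + 1), (A i * A (N - i) - G i * G (N - i)) * E i‖
      ≤ 2 * ∑ i ∈ Finset.range (N + 1), ‖A i - G i‖ := by
    calc _ ≤ ∑ i ∈ Finset.range (N + 1), (‖A i - G i‖ + ‖A (N - i) - G (N - i)‖) := by
          refine norm_sum_le_of_le _ fun i _ => ?_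
          rw [norm_mul, hE, Complex.norm_exp_ofReal_mul_I, mul_one]
          exact norm_mul_sub_mul_le (norm_centredChar_le hK _) (norm_gaussChar_le hK _)
      _ = _ := by
          rw [Finset.sum_add_distrib, Finset.sum_flip fun j => ‖A j - G j‖]; ring
  rw [← h2, ← norm_mul, h1, h2]
  refine (norm_add_le _ _).trans ?_
  have := gaussChar_recursion hb hb1 hK hs N
  linarith

lemma norm_centredChar_sub_gaussChar_le (hb : 0 ≤ b) (hb1 : b ≤ 1) (hbK : 1 + b ≤ K)
    (hK : 1 ≤ K) (hs : |s| ≤ 1 / 100) {n : ℕ} (hn : 2 * K ≤ n) :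
    ‖centredChar K b s n - gaussChar K b s n‖ ≤ 3240000 * |s| ^ 3 * treeVariance K b n := by
  have hKr : (1 : ℝ) ≤ K := by exact_mod_cast hK
  have hs3 : 0 ≤ |s| ^ 3 := by positivity
  have h1 := le_affine_of_recursion (K := K)
    (u := fun n => ‖centredChar K b s n - gaussChar K b s n‖)
    -- The comparison needs 48 + 2·27648 = 55344 ≤ 60000.
    (a := 60000 * |s| ^ 3 / (K * (K + 1))) (c := 27648 * |s| ^ 3 / K) (q := 48 * |s| ^ 3)
    (fun n hn => by
      simp only [centredChar_eq_one hK n hn, gaussChar, treeVariance_eq_zero hK n hn]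
      simp)
    (fun N _ => norm_centredChar_sub_gaussChar_succ_le hb hb1 hK hs N)
    (by
      have h2 : 2 * (27648 * |s| ^ 3 / K) * K = 55296 * |s| ^ 3 := by field_simp; ring
      have h3 : 60000 * |s| ^ 3 / (K * (K + 1)) * (K * (K + 1) : ℝ) = 60000 * |s| ^ 3 :=
        div_mul_cancel₀ _ (by positivity)
      rw [h2, h3]; linarith) hK n (by omega)
  have h4 : 0 ≤ 27648 * |s| ^ 3 / K := by positivity
  have h5 := le_varianceSlope hbK hb1 hK
  rw [treeVariance_eq hK n hn]
  -- The lower bound on `varianceSlope` trades K⁻² for the variance; 3240000 = 54·60000.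
  have h6 : 60000 * |s| ^ 3 / ((K : ℝ) * (K + 1)) ≤ 3240000 * |s| ^ 3 * varianceSlope K b := by
    calc 60000 * |s| ^ 3 / ((K : ℝ) * (K + 1)) ≤ 60000 * |s| ^ 3 / (K : ℝ) ^ 2 := by
          gcongr; nlinarith
      _ = 3240000 * |s| ^ 3 * (1 / (54 * (K : ℝ) ^ 2)) := by field_simp; ring
      _ ≤ _ := by gcongr
  calc _ ≤ 60000 * |s| ^ 3 / ((K : ℝ) * (K + 1)) * (n + 1) := by linarith
    _ ≤ 3240000 * |s| ^ 3 * varianceSlope K b * (n + 1) := by gcongr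
    _ = _ := by ring

end Bounds

/-! ### Shapes and labels of labelled binary trees -/

/-- The shape of a labelled binary tree. -/
def shape (t : BinaryTree ℕ) : BinaryTree Unit := t.map fun _ => ()

@[simp] lemma shape_nil : shape .nil = .nil := rfl

@[simp] lemma shape_node (a : ℕ) (l r : BinaryTree ℕ) :
    shape (.node a l r) = .node () (shape l) (shape r) := rfl

@[simp] lemma numNodes_shape (t : BinaryTree ℕ) : (shape t).numNodes = t.numNodes := by
  induction t with
  | nil => rfl
  | node a l r hl hr => simp [hl, hr]

lemma shape_map (e : ℕ → ℕ) (t : BinaryTree ℕ) : shape (t.map e) = shape t := by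
  rw [shape, ← BinaryTree.comp_map]; rfl

/-- The set of labels of a binary tree. -/
def labels : BinaryTree ℕ → Finset ℕ
  | .nil => ∅
  | .node a l r => insert a (labels l ∪ labels r)

@[simp] lemma labels_nil : labels .nil = ∅ := rfl

@[simp] lemma mem_labels_node {a x : ℕ} {l r : BinaryTree ℕ} :
    x ∈ labels (.node a l r) ↔ x = a ∨ x ∈ labels l ∨ x ∈ labels r := by
  simp [labels]

/-! ### The random binary search tree as a growing tree -/

/-- Search tree order: the labels to the left of a node are smaller, those to the right larger. -/
def IsSearchTree : BinaryTree ℕ → Prop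
  | .nil => True
  | .node a l r => (∀ y ∈ labels l, y < a) ∧ (∀ y ∈ labels r, a < y) ∧
      IsSearchTree l ∧ IsSearchTree r

lemma labels_bstInsert (t : BinaryTree ℕ) (x : ℕ) :
    labels (bstInsert t x) = insert x (labels t) := by
  induction t with
  | nil => simp [bstInsert, labels]
  | node a l r hl hr =>
    ext y
    simp only [bstInsert]
    split_ifs <;> simp only [mem_labels_node, hl, hr, Finset.mem_insert] <;> tauto

lemma IsSearchTree.bstInsert {t : BinaryTree ℕ} (h : IsSearchTree t) {x : ℕ} (hx : x ∉ labels t) :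
    IsSearchTree (bstInsert t x) := by
  induction t with
  | nil => simp [FringeTrees.bstInsert, IsSearchTree]
  | node a l r hl hr =>
    obtain ⟨h1, h2, h3, h4⟩ := h
    simp only [mem_labels_node, not_or] at hx
    simp only [FringeTrees.bstInsert]
    split_ifs with hxa
    · refine ⟨fun y hy => ?_, h2, hl h3 hx.2.1, h4⟩
      rw [labels_bstInsert, Finset.mem_insert] at hy
      rcases hy with rfl | hy
      exacts [hxa, h1 y hy]
    · refine ⟨h1, fun y hy => ?_, h3, hr h4 hx.2.2⟩
      rw [labels_bstInsert, Finset.mem_insert] at hy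
      rcases hy with rfl | hy
      exacts [by omega, h2 y hy]

lemma IsSearchTree.card_labels {t : BinaryTree ℕ} (h : IsSearchTree t) :
    (labels t).card = t.numNodes := by
  induction t with
  | nil => rfl
  | node a l r hl hr =>
    obtain ⟨h1, h2, h3, h4⟩ := h
    rw [labels, Finset.card_insert_of_notMem, Finset.card_union_of_disjoint, hl h3, hr h4]
    · rfl
    · exact Finset.disjoint_left.2 fun y hy hy' => by
        have := h1 y hy; have := h2 y hy'; omega
    · intro ha
      rcases Finset.mem_union.1 ha with ha | ha
      · exact absurd (h1 a ha) (lt_irrefl a)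
      · exact absurd (h2 a ha) (lt_irrefl a)

/-- Replace the `j`-th empty place of a binary tree, counted from the left, by a node. -/
def growAt : ℕ → BinaryTree Unit → BinaryTree Unit
  | _, .nil => .node () .nil .nil
  | j, .node _ l r =>
    if j ≤ l.numNodes then .node () (growAt j l) r else .node () l (growAt (j - (l.numNodes + 1)) r)

lemma growSum_eq_sum_growAt {R : Type*} [CommRing R] (t : BinaryTree Unit)
    (f : BinaryTree Unit → R) :
    growSum t f = ∑ j ∈ Finset.range (t.numNodes + 1), f (growAt j t) := by
  induction t generalizing f with
  | nil => simp [growSum, growAt]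
  | node a l r hl hr =>
    rw [growSum, hl, hr, BinaryTree.numNodes,
      show l.numNodes + r.numNodes + 1 + 1 = (l.numNodes + 1) + (r.numNodes + 1) by ring,
      Finset.sum_range_add _ (l.numNodes + 1)]
    refine congrArg₂ (· + ·) ?_ ?_
    · refine Finset.sum_congr rfl fun j hj => ?_
      rw [growAt, if_pos (Nat.lt_succ_iff.1 (Finset.mem_range.1 hj))]
    · refine Finset.sum_congr rfl fun j _ => ?_
      rw [growAt, if_neg (by omega), Nat.add_sub_cancel_left]

/-- The empty places of a search tree, read from the left, are the gaps between its keys, so the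
rank of the new key is the index of the place it fills. -/
lemma shape_bstInsert {t : BinaryTree ℕ} (h : IsSearchTree t) {x : ℕ} (hx : x ∉ labels t) :
    shape (bstInsert t x) = growAt ((labels t).filter (· < x)).card (shape t) := by
  induction t with
  | nil => rfl
  | node a l r hl hr =>
    obtain ⟨h1, h2, h3, h4⟩ := h
    simp only [mem_labels_node, not_or] at hx
    simp only [bstInsert]
    split_ifs with hxa
    · have hf : (labels (.node a l r)).filter (· < x) = (labels l).filter (· < x) := by
        ext y
        simp only [Finset.mem_filter, mem_labels_node]
        refine ⟨fun ⟨hy, hyx⟩ => ⟨?_, hyx⟩, fun hy => ⟨Or.inr (Or.inl hy.1), hy.2⟩⟩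
        rcases hy with rfl | hy | hy
        · omega
        · exact hy
        · have := h2 y hy; omega
      have hc : ((labels l).filter (· < x)).card ≤ (shape l).numNodes := by
        rw [numNodes_shape, ← h3.card_labels]; exact Finset.card_filter_le _ _
      rw [hf, shape_node, shape_node, growAt, if_pos hc, hl h3 hx.2.1]
    · have hax : a < x := by omega
      have hf : (labels (.node a l r)).filter (· < x)
          = insert a (labels l ∪ (labels r).filter (· < x)) := by
        ext y
        simp only [Finset.mem_filter, mem_labels_node, Finset.mem_insert, Finset.mem_union]
        constructor
        · tauto
        · rintro (rfl | hy | hy)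
          · exact ⟨Or.inl rfl, hax⟩
          · exact ⟨Or.inr (Or.inl hy), (h1 y hy).trans hax⟩
          · exact ⟨Or.inr (Or.inr hy.1), hy.2⟩
      have hc : ((labels (.node a l r)).filter (· < x)).card
          = (shape l).numNodes + 1 + ((labels r).filter (· < x)).card := by
        rw [hf, Finset.card_insert_of_notMem, Finset.card_union_of_disjoint, numNodes_shape,
          h3.card_labels]
        · ring
        · exact Finset.disjoint_left.2 fun y hy hy' => by
            have := h1 y hy; have := h2 y (Finset.mem_filter.1 hy').1; omega
        · intro ha
          rcases Finset.mem_union.1 ha with ha | ha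
          · exact absurd (h1 a ha) (lt_irrefl a)
          · exact absurd (h2 a (Finset.mem_filter.1 ha).1) (lt_irrefl a)
      rw [hc, shape_node, shape_node, growAt, if_neg (by omega), Nat.add_sub_cancel_left,
        hr h4 hx.2.2]

lemma bstInsert_map {e : ℕ → ℕ} (he : StrictMono e) (t : BinaryTree ℕ) (x : ℕ) :
    bstInsert (t.map e) (e x) = (bstInsert t x).map e := by
  induction t with
  | nil => rfl
  | node a l r hl hr =>
    simp only [BinaryTree.map, bstInsert, he.lt_iff_lt]
    split_ifs <;> simp only [BinaryTree.map, hl, hr]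

lemma bstOfList_append_singleton (L : List ℕ) (x : ℕ) :
    bstOfList (L ++ [x]) = bstInsert (bstOfList L) x := by
  simp [bstOfList]

lemma bstOfList_map {e : ℕ → ℕ} (he : StrictMono e) (L : List ℕ) :
    bstOfList (L.map e) = (bstOfList L).map e := by
  induction L using List.reverseRecOn with
  | nil => rfl
  | append_singleton L x ih =>
    rw [List.map_append, List.map_singleton, bstOfList_append_singleton,
      bstOfList_append_singleton, ih, bstInsert_map he]

lemma labels_bstOfList (L : List ℕ) : labels (bstOfList L) = L.toFinset := by
  induction L using List.reverseRecOn with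
  | nil => rfl
  | append_singleton L x ih =>
    rw [bstOfList_append_singleton, labels_bstInsert, ih]
    ext y; simp

lemma isSearchTree_bstOfList {L : List ℕ} (hL : L.Nodup) : IsSearchTree (bstOfList L) := by
  induction L using List.reverseRecOn with
  | nil => trivial
  | append_singleton L x ih =>
    rw [bstOfList_append_singleton]
    rw [List.nodup_append] at hL
    refine (ih hL.1).bstInsert ?_
    rw [labels_bstOfList, List.mem_toFinset]
    exact fun hx => hL.2.2 x hx x (by simp) rfl

/-- The permutation with last value `j` whose other values are ordered like those of `τ`. -/
def snocPerm {n : ℕ} (j : Fin (n + 1)) (τ : Equiv.Perm (Fin n)) : Equiv.Perm (Fin (n + 1)) :=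
  ((finSuccEquiv' (Fin.last n)).trans (Equiv.optionCongr τ)).trans (finSuccEquiv' j).symm

lemma snocPerm_last {n : ℕ} (j : Fin (n + 1)) (τ : Equiv.Perm (Fin n)) :
    snocPerm j τ (Fin.last n) = j := by
  simp [snocPerm]

lemma snocPerm_castSucc {n : ℕ} (j : Fin (n + 1)) (τ : Equiv.Perm (Fin n)) (i : Fin n) :
    snocPerm j τ i.castSucc = j.succAbove (τ i) := by
  simp [snocPerm, finSuccEquiv'_last_apply_castSucc]

lemma bijective_snocPerm (n : ℕ) :
    Function.Bijective fun x : Fin (n + 1) × Equiv.Perm (Fin n) => snocPerm x.1 x.2 := by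
  rw [Fintype.bijective_iff_injective_and_card]
  constructor
  · rintro ⟨j, τ⟩ ⟨j', τ'⟩ h
    simp only at h
    have hj : j = j' := by rw [← snocPerm_last j τ, h, snocPerm_last]
    subst hj
    refine Prod.ext rfl (Equiv.ext fun i => ?_)
    have := congrArg (fun σ => σ i.castSucc) h
    simp only [snocPerm_castSucc] at this
    exact Fin.succAbove_right_injective this
  · simp [Fintype.card_perm, Nat.factorial_succ]

/-- The first n keys are those of τ moved by an increasing map that skips j. This does not affect
the shape, and exactly j of them are smaller than the last key. -/
lemma shape_bst_snocPerm {n : ℕ} (j : Fin (n + 1)) (τ : Equiv.Perm (Fin n)) :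
    shape (bst (snocPerm j τ)) = growAt j (shape (bst τ)) := by
  set e : ℕ → ℕ := fun y => if y < j then y else y + 1 with he
  have hmono : StrictMono e := by
    intro x y hxy
    simp only [he]
    split_ifs <;> omega
  have hL : (List.ofFn fun i => (snocPerm j τ i : ℕ))
      = (List.ofFn fun i => (τ i : ℕ)).map e ++ [(j : ℕ)] := by
    rw [List.ofFn_succ', List.concat_eq_append, snocPerm_last, List.map_ofFn]
    congr 2
    funext i
    rw [snocPerm_castSucc, Function.comp_apply, he]
    simp only [Fin.succAbove, Fin.lt_def, Fin.val_castSucc]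
    split_ifs <;> rfl
  have hnodup : ((List.ofFn fun i => (τ i : ℕ)).map e).Nodup := by
    refine List.Nodup.map hmono.injective ?_
    exact List.nodup_ofFn.2 (Fin.val_injective.comp τ.injective)
  have hmem : ∀ y, y ∈ labels (bstOfList ((List.ofFn fun i => (τ i : ℕ)).map e))
      ↔ ∃ x < n, e x = y := by
    intro y
    simp only [labels_bstOfList, List.mem_toFinset, List.mem_map, List.mem_ofFn]
    constructor
    · rintro ⟨x, ⟨i, rfl⟩, rfl⟩
      exact ⟨_, (τ i).isLt, rfl⟩
    · rintro ⟨x, hx, rfl⟩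
      exact ⟨x, ⟨τ.symm ⟨x, hx⟩, by simp⟩, rfl⟩
  have hj : (j : ℕ) ∉ labels (bstOfList ((List.ofFn fun i => (τ i : ℕ)).map e)) := by
    rw [hmem]
    rintro ⟨x, -, hx⟩
    simp only [he] at hx
    split_ifs at hx <;> omega
  have hcard : ((labels (bstOfList ((List.ofFn fun i => (τ i : ℕ)).map e))).filter (· < (j : ℕ))).card
      = j := by
    have : (labels (bstOfList ((List.ofFn fun i => (τ i : ℕ)).map e))).filter (· < (j : ℕ))
        = Finset.range j := by
      ext y
      rw [Finset.mem_filter, hmem, Finset.mem_range]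
      refine ⟨fun h => h.2, fun h => ⟨⟨y, by omega, by simp [he, h]⟩, h⟩⟩
    rw [this, Finset.card_range]
  rw [bst, hL, bstOfList_append_singleton,
    shape_bstInsert (isSearchTree_bstOfList hnodup) hj, hcard, bstOfList_map hmono, shape_map, bst]

lemma numNodes_bst {n : ℕ} (σ : Equiv.Perm (Fin n)) : (bst σ).numNodes = n := by
  have hnd : (List.ofFn fun i => (σ i : ℕ)).Nodup :=
    List.nodup_ofFn.2 (Fin.val_injective.comp σ.injective)
  rw [bst, ← (isSearchTree_bstOfList hnd).card_labels, labels_bstOfList,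
    List.toFinset_card_of_nodup hnd, List.length_ofFn]

lemma sum_perm_shape_bst {R : Type*} [CommRing R] (n : ℕ) (f : BinaryTree Unit → R) :
    ∑ σ : Equiv.Perm (Fin n), f (shape (bst σ)) = growthSum n f .nil := by
  induction n generalizing f with
  | zero => simp [growthSum, bst, bstOfList]
  | succ n ih =>
    rw [growthSum, ← ih, ← Equiv.sum_comp (Equiv.ofBijective _ (bijective_snocPerm n)),
      Fintype.sum_prod_type_right]
    refine Finset.sum_congr rfl fun τ _ => ?_
    rw [growSum_eq_sum_growAt, numNodes_shape, numNodes_bst, Finset.sum_range]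
    refine Finset.sum_congr rfl fun j _ => ?_
    rw [← shape_bst_snocPerm]; rfl

lemma fringeCount_node (k a : ℕ) (l r : BinaryTree ℕ) :
    fringeCount k (.node a l r) = fringeCount k l + fringeCount k r
      + if (BinaryTree.node a l r).numNodes = k then 1 else 0 := by
  simp only [fringeCount, fringeSubtrees, List.countP_cons, List.countP_append,
    decide_eq_true_eq]

/-- Every fringe subtree except the whole tree is the left or right subtree of a unique parent.
Positivity of k keeps empty subtrees from being counted. -/
lemma fringeCount_eq {k : ℕ} (hk : 1 ≤ k) (t : BinaryTree ℕ) :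
    (fringeCount k t : ℝ)
      = childCount (k + 1) 1 (shape t) + if t.numNodes = k then 1 else 0 := by
  induction t with
  | nil => 
    have : ¬ (0 = k) := by omega
    simp [fringeCount, fringeSubtrees, childCount, this]
  | node a l r hl hr =>
    rw [fringeCount_node]
    push_cast
    rw [hl, hr]
    simp only [shape_node, childCount, numNodes_shape, Nat.add_right_cancel_iff]
    ring

/-! ### The random recursive tree as a growing binary tree

The forest of the nodes other than the root is encoded as a binary tree: the left subtree of a node
holds its descendants, the right subtree its younger siblings and their descendants. -/

/-- Attach a new node labelled `n` as the youngest tree of a forest. -/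
def addSibling (n : ℕ) : BinaryTree ℕ → BinaryTree ℕ
  | .nil => .node n .nil .nil
  | .node a l r => .node a l (addSibling n r)

/-- Attach a new node labelled `n` as the youngest child of the node labelled `q`. -/
def addChild (q n : ℕ) : BinaryTree ℕ → BinaryTree ℕ
  | .nil => .nil
  | .node a l r =>
    if a = q then .node a (addSibling n l) r else .node a (addChild q n l) (addChild q n r)

/-- The labels of a binary tree are distinct. -/
def DistinctLabels : BinaryTree ℕ → Prop
  | .nil => True
  | .node a l r => a ∉ labels l ∧ a ∉ labels r ∧ Disjoint (labels l) (labels r) ∧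
      DistinctLabels l ∧ DistinctLabels r

/-- The labels in the left subtree of the node labelled `v`. -/
def labelsBelow (v : ℕ) : BinaryTree ℕ → Finset ℕ
  | .nil => ∅
  | .node a l r => (if v = a then labels l else ∅) ∪ (labelsBelow v l ∪ labelsBelow v r)

lemma mem_labelsBelow_node {v w a : ℕ} {l r : BinaryTree ℕ} :
    w ∈ labelsBelow v (.node a l r)
      ↔ (v = a ∧ w ∈ labels l) ∨ w ∈ labelsBelow v l ∨ w ∈ labelsBelow v r := by
  simp only [labelsBelow, Finset.mem_union]
  split_ifs with h <;> simp [h]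

lemma DistinctLabels.card_labels {t : BinaryTree ℕ} (h : DistinctLabels t) :
    (labels t).card = t.numNodes := by
  induction t with
  | nil => rfl
  | node a l r hl hr =>
    obtain ⟨h1, h2, h3, h4, h5⟩ := h
    rw [labels, Finset.card_insert_of_notMem (by simp [h1, h2]), Finset.card_union_of_disjoint h3,
      hl h4, hr h5]
    rfl

lemma mem_labels_of_mem_labelsBelow {t : BinaryTree ℕ} {v w : ℕ} (h : w ∈ labelsBelow v t) :
    w ∈ labels t ∧ v ∈ labels t := by
  induction t with
  | nil => simp [labelsBelow] at h
  | node a l r hl hr =>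
    rw [mem_labelsBelow_node] at h
    simp only [mem_labels_node]
    rcases h with ⟨rfl, h⟩ | h | h
    · exact ⟨Or.inr (Or.inl h), Or.inl rfl⟩
    · exact ⟨Or.inr (Or.inl (hl h).1), Or.inr (Or.inl (hl h).2)⟩
    · exact ⟨Or.inr (Or.inr (hr h).1), Or.inr (Or.inr (hr h).2)⟩

lemma labels_addSibling (n : ℕ) (t : BinaryTree ℕ) :
    labels (addSibling n t) = insert n (labels t) := by
  induction t with
  | nil => simp [addSibling, labels]
  | node a l r hl hr =>
    ext y
    simp only [addSibling, mem_labels_node, hr, Finset.mem_insert]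
    tauto

lemma addChild_of_notMem {q n : ℕ} {t : BinaryTree ℕ} (h : q ∉ labels t) : addChild q n t = t := by
  induction t with
  | nil => rfl
  | node a l r hl hr =>
    simp only [mem_labels_node, not_or] at h
    rw [addChild, if_neg (Ne.symm h.1), hl h.2.1, hr h.2.2]

lemma labels_addChild {q n : ℕ} {t : BinaryTree ℕ} (h : q ∈ labels t) :
    labels (addChild q n t) = insert n (labels t) := by
  induction t with
  | nil => simp at h
  | node a l r hl hr =>
    rw [addChild]
    split_ifs with haq
    · ext y
      simp only [mem_labels_node, labels_addSibling, Finset.mem_insert]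
      tauto
    · rw [mem_labels_node, or_iff_right (Ne.symm haq)] at h
      ext y
      simp only [mem_labels_node, Finset.mem_insert]
      by_cases h1 : q ∈ labels l <;> by_cases h2 : q ∈ labels r
      · simp only [hl h1, hr h2, Finset.mem_insert]; tauto
      · simp only [hl h1, addChild_of_notMem h2, Finset.mem_insert]; tauto
      · simp only [hr h2, addChild_of_notMem h1, Finset.mem_insert]; tauto
      · tauto

lemma DistinctLabels.addSibling {n : ℕ} {t : BinaryTree ℕ} (h : DistinctLabels t)
    (hn : n ∉ labels t) : DistinctLabels (addSibling n t) := by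
  induction t with
  | nil => simp [FringeTrees.addSibling, DistinctLabels]
  | node a l r hl hr =>
    obtain ⟨h1, h2, h3, h4, h5⟩ := h
    simp only [mem_labels_node, not_or] at hn
    refine ⟨h1, ?_, ?_, h4, hr h5 hn.2.2⟩
    · rw [labels_addSibling, Finset.mem_insert, not_or]
      exact ⟨Ne.symm hn.1, h2⟩
    · rw [labels_addSibling, Finset.disjoint_insert_right]
      exact ⟨hn.2.1, h3⟩

lemma DistinctLabels.addChild {q n : ℕ} {t : BinaryTree ℕ} (h : DistinctLabels t)
    (hn : n ∉ labels t) : DistinctLabels (addChild q n t) := by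
  induction t with
  | nil => trivial
  | node a l r hl hr =>
    obtain ⟨h1, h2, h3, h4, h5⟩ := h
    simp only [mem_labels_node, not_or] at hn
    rw [FringeTrees.addChild]
    split_ifs with haq
    · refine ⟨?_, h2, ?_, h4.addSibling hn.2.1, h5⟩
      · rw [labels_addSibling, Finset.mem_insert, not_or]
        exact ⟨Ne.symm hn.1, h1⟩
      · rw [labels_addSibling, Finset.disjoint_insert_left]
        exact ⟨hn.2.2, h3⟩
    · by_cases hq : q ∈ labels l
      · have hq' : q ∉ labels r := Finset.disjoint_left.1 h3 hq
        rw [addChild_of_notMem hq']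
        refine ⟨?_, h2, ?_, hl h4 hn.2.1, h5⟩
        · rw [labels_addChild hq, Finset.mem_insert, not_or]
          exact ⟨Ne.symm hn.1, h1⟩
        · rw [labels_addChild hq, Finset.disjoint_insert_left]
          exact ⟨hn.2.2, h3⟩
      · rw [addChild_of_notMem hq]
        by_cases hq' : q ∈ labels r
        · refine ⟨h1, ?_, ?_, h4, hr h5 hn.2.2⟩
          · rw [labels_addChild hq', Finset.mem_insert, not_or]
            exact ⟨Ne.symm hn.1, h2⟩
          · rw [labels_addChild hq', Finset.disjoint_insert_right]
            exact ⟨hn.2.1, h3⟩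
        · rw [addChild_of_notMem hq']
          exact ⟨h1, h2, h3, h4, h5⟩

lemma labelsBelow_addSibling {n v : ℕ} (t : BinaryTree ℕ) :
    labelsBelow v (addSibling n t) = labelsBelow v t := by
  induction t with
  | nil => simp [addSibling, labelsBelow]
  | node a l r hl hr => simp only [addSibling, labelsBelow, hr]

/-- The new node is a leaf of the recursive tree, so its ancestors in the forest are its parent and
the ancestors of its parent. -/
lemma mem_labelsBelow_addChild {q n v w : ℕ} {t : BinaryTree ℕ} (h : DistinctLabels t)
    (hq : q ∈ labels t) :
    w ∈ labelsBelow v (addChild q n t)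
      ↔ w ∈ labelsBelow v t ∨ (w = n ∧ (v = q ∨ q ∈ labelsBelow v t)) := by
  induction t with
  | nil => simp at hq
  | node a l r hl hr =>
    obtain ⟨h1, h2, h3, h4, h5⟩ := h
    rw [addChild]
    split_ifs with haq
    · subst haq
      have hbl : a ∉ labelsBelow v l := fun hb => h1 (mem_labels_of_mem_labelsBelow hb).1
      have hbr : a ∉ labelsBelow v r := fun hb => h2 (mem_labels_of_mem_labelsBelow hb).1
      simp only [mem_labelsBelow_node, labels_addSibling, labelsBelow_addSibling,
        Finset.mem_insert, h1, hbl, hbr, and_false, or_false]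
      clear hl hr
      grind
    · rw [mem_labels_node, or_iff_right (Ne.symm haq)] at hq
      by_cases hql : q ∈ labels l
      · have hqr : q ∉ labels r := Finset.disjoint_left.1 h3 hql
        have hbr : q ∉ labelsBelow v r := fun hb => hqr (mem_labels_of_mem_labelsBelow hb).1
        simp only [mem_labelsBelow_node, addChild_of_notMem hqr, labels_addChild hql, hl h4 hql,
          Finset.mem_insert, hql, hbr, and_true, or_false]
        clear hl hr
        grind
      · have hqr : q ∈ labels r := hq.resolve_left hql
        have hbl : q ∉ labelsBelow v l := fun hb => hql (mem_labels_of_mem_labelsBelow hb).1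
        simp only [mem_labelsBelow_node, addChild_of_notMem hql, hr h5 hqr, hql, hbl,
          and_false, false_or]
        clear hl hr
        grind

/-- The empty places of the binary tree of a forest correspond to the possible parents of a new
node: the nodes of the forest and the root. -/
lemma growSum_shape {R : Type*} [CommRing R] {t : BinaryTree ℕ} (h : DistinctLabels t) (n : ℕ)
    (f : BinaryTree Unit → R) :
    growSum (shape t) f
      = f (shape (addSibling n t)) + ∑ q ∈ labels t, f (shape (addChild q n t)) := by
  induction t generalizing f with
  | nil => simp [growSum, addSibling]
  | node a l r hl hr =>
    obtain ⟨h1, h2, h3, h4, h5⟩ := h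
    rw [shape_node, growSum, hl h4, hr h5, labels, Finset.sum_insert (by simp [h1, h2]),
      Finset.sum_union h3]
    have e1 : ∀ q ∈ labels l, f (shape (addChild q n (.node a l r)))
        = f (.node () (shape (addChild q n l)) (shape r)) := fun q hq => by
      rw [addChild, if_neg (by rintro rfl; exact h1 hq),
        addChild_of_notMem (t := r) (Finset.disjoint_left.1 h3 hq), shape_node]
    have e2 : ∀ q ∈ labels r, f (shape (addChild q n (.node a l r)))
        = f (.node () (shape l) (shape (addChild q n r))) := fun q hq => by
      rw [addChild, if_neg (by rintro rfl; exact h2 hq),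
        addChild_of_notMem (t := l) (Finset.disjoint_right.1 h3 hq), shape_node]
    -- The place at the end of the right spine of `l`, which the induction hypothesis treats as a
    -- new sibling in `l`, is the place for a new child of `a`.
    rw [Finset.sum_congr rfl e1, Finset.sum_congr rfl e2, addChild, if_pos rfl, addSibling,
      shape_node, shape_node]
    ring

lemma labelsBelow_of_notMem {v : ℕ} {t : BinaryTree ℕ} (h : v ∉ labels t) :
    labelsBelow v t = ∅ :=
  Finset.eq_empty_of_forall_notMem fun _ hw => h (mem_labels_of_mem_labelsBelow hw).2

/-- With b = 0 only left subtrees count, and the left subtree of a node holds exactly its proper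
descendants. -/
lemma childCount_eq_card {t : BinaryTree ℕ} (h : DistinctLabels t) (k : ℕ) :
    childCount k 0 (shape t)
      = (((labels t).filter fun v => (labelsBelow v t).card + 1 = k).card : ℝ) := by
  induction t with
  | nil => simp [childCount]
  | node a l r hl hr =>
    obtain ⟨h1, h2, h3, h4, h5⟩ := h
    have e0 : labelsBelow a (.node a l r) = labels l := by
      simp [labelsBelow, labelsBelow_of_notMem h1, labelsBelow_of_notMem h2]
    have e1 : ∀ v ∈ labels l, ((labelsBelow v (.node a l r)).card + 1 = k
        ↔ (labelsBelow v l).card + 1 = k) := fun v hv => by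
      rw [labelsBelow, if_neg (by rintro rfl; exact h1 hv),
        labelsBelow_of_notMem (t := r) (Finset.disjoint_left.1 h3 hv)]
      simp
    have e2 : ∀ v ∈ labels r, ((labelsBelow v (.node a l r)).card + 1 = k
        ↔ (labelsBelow v r).card + 1 = k) := fun v hv => by
      rw [labelsBelow, if_neg (by rintro rfl; exact h2 hv),
        labelsBelow_of_notMem (t := l) (Finset.disjoint_right.1 h3 hv)]
      simp
    rw [shape_node, childCount, hl h4, hr h5, Finset.card_filter, Finset.card_filter,
      Finset.card_filter, labels, Finset.sum_insert (by simp [h1, h2]), Finset.sum_union h3,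
      Finset.sum_congr rfl fun v hv => if_congr (e1 v hv) rfl rfl,
      Finset.sum_congr rfl fun v hv => if_congr (e2 v hv) rfl rfl, e0, h4.card_labels,
      numNodes_shape]
    push_cast
    split_ifs <;> ring

/-- The binary tree encoding the forest of the nodes other than the root of a recursive tree. -/
def forest : (N : ℕ) → Attachments (N + 1) → BinaryTree ℕ
  | 0, _ => .nil
  | N + 1, p =>
    let q : ℕ := (p (Fin.last N) : ℕ)
    let t := forest N fun i => p (Fin.castSucc i)
    if q = 0 then addSibling (N + 1) t else addChild q (N + 1) t

lemma forest_succ (N : ℕ) (p : Attachments (N + 2)) :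
    forest (N + 1) p = if (p (Fin.last N) : ℕ) = 0
      then addSibling (N + 1) (forest N fun i => p (Fin.castSucc i))
      else addChild (p (Fin.last N) : ℕ) (N + 1) (forest N fun i => p (Fin.castSucc i)) := rfl

lemma labels_forest (N : ℕ) (p : Attachments (N + 1)) :
    labels (forest N p) = Finset.Icc 1 N := by
  induction N with
  | zero => rfl
  | succ N ih =>
    have hins : insert (N + 1) (Finset.Icc 1 N) = Finset.Icc 1 (N + 1) := by
      ext y; simp only [Finset.mem_insert, Finset.mem_Icc]; omega
    rw [forest_succ]
    split_ifs with hq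
    · rw [labels_addSibling, ih, hins]
    · have hlt : (p (Fin.last N) : ℕ) < N + 1 := (p (Fin.last N)).isLt
      rw [labels_addChild, ih, hins]
      rw [ih, Finset.mem_Icc]
      omega

lemma distinctLabels_forest (N : ℕ) (p : Attachments (N + 1)) :
    DistinctLabels (forest N p) := by
  induction N with
  | zero => trivial
  | succ N ih =>
    have hn : N + 1 ∉ labels (forest N fun i => p (Fin.castSucc i)) := by
      rw [labels_forest, Finset.mem_Icc]; omega
    rw [forest_succ]
    split_ifs
    exacts [(ih _).addSibling hn, (ih _).addChild hn]

/-- The last attachment is split off with `Fin.snocEquiv`: parent 0 adds a sibling, the other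
parents are the labels of the forest, and together they exhaust the empty places. -/
lemma sum_attachments_shape {R : Type*} [CommRing R] (N : ℕ) (f : BinaryTree Unit → R) :
    ∑ p : Attachments (N + 1), f (shape (forest N p)) = growthSum N f .nil := by
  induction N generalizing f with
  | zero =>
    have : IsEmpty (Fin (0 + 1 - 1)) := inferInstanceAs (IsEmpty (Fin 0))
    have : Unique (Attachments (0 + 1)) := Pi.uniqueOfIsEmpty _
    rw [Fintype.sum_unique]; rfl
  | succ N ih =>
    rw [growthSum, ← ih]
    refine (Equiv.sum_comp (Fin.snocEquiv fun i : Fin (N + 1) => Fin ((i : ℕ) + 1))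
      fun p : Attachments (N + 2) => f (shape (forest (N + 1) p))).symm.trans ?_
    rw [Fintype.sum_prod_type_right]
    refine Finset.sum_congr rfl fun p _ => ?_
    have hf : ∀ q : Fin (N + 1), forest (N + 1)
        (Fin.snocEquiv (fun i : Fin (N + 1) => Fin ((i : ℕ) + 1)) (q, p))
        = if (q : ℕ) = 0 then addSibling (N + 1) (forest N p)
          else addChild q (N + 1) (forest N p) := by
      intro q
      rw [forest_succ]
      simp [Fin.snocEquiv]
    have hl : labels (forest N p) = (Finset.range N).map (addRightEmbedding 1) := by
      rw [labels_forest]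
      ext y
      simp only [Finset.mem_Icc, Finset.mem_map, Finset.mem_range, addRightEmbedding_apply]
      exact ⟨fun h => ⟨y - 1, by omega⟩, by rintro ⟨x, hx, rfl⟩; omega⟩
    rw [growSum_shape (distinctLabels_forest N p) (N + 1), hl, Finset.sum_map]
    simp only [hf]
    refine (Finset.sum_range fun q : ℕ => f (shape (if q = 0 then addSibling (N + 1) (forest N p)
      else addChild q (N + 1) (forest N p)))).symm.trans ?_
    rw [Finset.sum_range_succ', add_comm]
    simp

lemma notMem_labelsBelow_self {t : BinaryTree ℕ} (h : DistinctLabels t) (v : ℕ) :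
    v ∉ labelsBelow v t := by
  induction t with
  | nil => simp [labelsBelow]
  | node a l r hl hr =>
    obtain ⟨h1, h2, h3, h4, h5⟩ := h
    rw [mem_labelsBelow_node]
    rintro (⟨rfl, hv⟩ | hv | hv)
    exacts [h1 hv, hl h4 hv, hr h5 hv]

lemma mem_rrtSubtree_iff {n : ℕ} (p : Attachments n) (v w : Fin n) :
    w ∈ rrtSubtree p v ↔ w = v ∨ rrtParent p w ∈ rrtSubtree p v := by
  constructor
  · rintro ⟨m, hm⟩
    cases m with
    | zero => exact Or.inl hm
    | succ m => exact Or.inr ⟨m, by rwa [Function.iterate_succ_apply] at hm⟩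
  · rintro (rfl | ⟨m, hm⟩)
    · exact ⟨0, rfl⟩
    · exact ⟨m + 1, by rwa [Function.iterate_succ_apply]⟩

/-! ### Descendants in the recursive tree and in its forest encoding. -/

section Snoc

variable {N : ℕ} (p : Attachments (N + 2))

lemma rrtParent_castSucc (w : Fin (N + 1)) :
    rrtParent p w.castSucc
      = (rrtParent (n := N + 1) (fun i => p (Fin.castSucc (n := N) i)) w).castSucc := by
  unfold rrtParent
  by_cases h : (w : ℕ) = 0
  · rw [dif_pos h, dif_pos (by simpa using h)]
  · rw [dif_neg h, dif_neg (by simpa using h)]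
    rfl

lemma val_rrtParent_last : (rrtParent p (Fin.last (N + 1)) : ℕ) = p (Fin.last N) := by
  unfold rrtParent
  rw [dif_neg (by simp)]
  rfl

lemma castSucc_mem_rrtSubtree_castSucc (v w : Fin (N + 1)) :
    w.castSucc ∈ rrtSubtree p v.castSucc
      ↔ w ∈ rrtSubtree (n := N + 1) (fun i => p (Fin.castSucc (n := N) i)) v := by
  have h : Function.Semiconj (Fin.castSucc (n := N + 1))
      (rrtParent (n := N + 1) (fun i => p (Fin.castSucc (n := N) i))) (rrtParent p) :=
    fun w => (rrtParent_castSucc p w).symm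
  refine exists_congr fun m => ?_
  rw [← (h.iterate_right m).eq, Fin.castSucc_inj]

lemma castSucc_notMem_rrtSubtree_last (w : Fin (N + 1)) :
    w.castSucc ∉ rrtSubtree p (Fin.last (N + 1)) := by
  have h : Function.Semiconj (Fin.castSucc (n := N + 1))
      (rrtParent (n := N + 1) (fun i => p (Fin.castSucc (n := N) i))) (rrtParent p) :=
    fun w => (rrtParent_castSucc p w).symm
  rintro ⟨m, hm⟩
  rw [← (h.iterate_right m).eq] at hm
  exact Fin.castSucc_ne_last _ hm

end Snoc

/-- Induction by removing the last node, which has no children: it descends from an older v exactly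
when its parent lies in the subtree of v. The root is excluded because the forest omits it. -/
lemma mem_rrtSubtree_iff_labelsBelow (N : ℕ) (p : Attachments (N + 1)) (v w : Fin (N + 1))
    (hv : (v : ℕ) ≠ 0) :
    w ∈ rrtSubtree p v ↔ w = v ∨ (w : ℕ) ∈ labelsBelow v (forest N p) := by
  induction N with
  | zero => exact absurd (by omega) hv
  | succ N ih =>
    set p₀ : Attachments (N + 1) := fun i => p (Fin.castSucc (n := N) i) with hp₀
    have hlab : ∀ y : ℕ, y ∈ labels (forest N p₀) ↔ 1 ≤ y ∧ y ≤ N := fun y => by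
      rw [labels_forest, Finset.mem_Icc]
    have hlt : (p (Fin.last N) : ℕ) < N + 1 := (p (Fin.last N)).isLt
    have hbelow : ∀ x y : ℕ, y ∈ labelsBelow x (forest (N + 1) p) ↔
        y ∈ labelsBelow x (forest N p₀) ∨ (y = N + 1 ∧ (p (Fin.last N) : ℕ) ≠ 0 ∧
          (x = p (Fin.last N) ∨ (p (Fin.last N) : ℕ) ∈ labelsBelow x (forest N p₀))) := by
      intro x y
      rw [forest_succ]
      split_ifs with hq
      · rw [labelsBelow_addSibling]; simp [hq, hp₀]
      · rw [mem_labelsBelow_addChild (distinctLabels_forest N p₀) ((hlab _).2 (by omega))]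
        simp [hq]
    have hlast : N + 1 ∉ labels (forest N p₀) := by rw [hlab]; omega
    rw [hbelow]
    induction w using Fin.lastCases with
    | last =>
      induction v using Fin.lastCases with
      | last => exact iff_of_true ⟨0, rfl⟩ (Or.inl rfl)
      | cast v =>
        have hne : Fin.last (N + 1) ≠ v.castSucc := (Fin.castSucc_ne_last v).symm
        have hpar : rrtParent p (Fin.last (N + 1)) = Fin.castSucc ⟨p (Fin.last N), hlt⟩ :=
          Fin.ext (val_rrtParent_last p)
        have hn : N + 1 ∉ labelsBelow v (forest N p₀) := fun h =>
          hlast (mem_labels_of_mem_labelsBelow h).1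
        have hb0 : (p (Fin.last N) : ℕ) ∈ labelsBelow v (forest N p₀) →
            (p (Fin.last N) : ℕ) ≠ 0 := fun h => by
          have := (hlab _).1 (mem_labels_of_mem_labelsBelow h).1; omega
        rw [mem_rrtSubtree_iff, hpar, castSucc_mem_rrtSubtree_castSucc, ih p₀ v _ hv,
          or_iff_right hne]
        constructor
        · rintro (h | h)
          · have hqv : (p (Fin.last N) : ℕ) = v := congrArg Fin.val h
            exact Or.inr (Or.inr ⟨rfl, fun h0 => hv (hqv.symm.trans h0), Or.inl hqv.symm⟩)
          · exact Or.inr (Or.inr ⟨rfl, hb0 h, Or.inr h⟩)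
        · rintro (h | h | ⟨-, -, h | h⟩)
          · exact absurd h hne
          · exact absurd h hn
          · exact Or.inl (Fin.ext h.symm)
          · exact Or.inr h
    | cast w =>
      have hw : (w : ℕ) ≠ N + 1 := by omega
      induction v using Fin.lastCases with
      | last =>
        refine iff_of_false (castSucc_notMem_rrtSubtree_last p w) ?_
        rintro (h | h | h)
        · exact Fin.castSucc_ne_last w h
        · exact hlast (mem_labels_of_mem_labelsBelow h).2
        · exact hw h.1
      | cast v =>
        rw [castSucc_mem_rrtSubtree_castSucc, ih p₀ v w hv]
        constructor
        · rintro (h | h)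
          exacts [Or.inl (congrArg _ h), Or.inr (Or.inl h)]
        · rintro (h | h | h)
          exacts [Or.inl (Fin.castSucc_injective _ h), Or.inr h, absurd h.1 hw]

lemma mem_rrtSubtree_zero (N : ℕ) (p : Attachments (N + 1)) (w : Fin (N + 1)) :
    w ∈ rrtSubtree p 0 := by
  induction N with
  | zero => exact ⟨0, Fin.ext (Nat.lt_one_iff.1 w.isLt)⟩
  | succ N ih =>
    have key : ∀ w : Fin (N + 1), w.castSucc ∈ rrtSubtree p 0 := fun w =>
      (castSucc_mem_rrtSubtree_castSucc p 0 w).2 (ih _ w)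
    induction w using Fin.lastCases with
    | last =>
      have hlt : (p (Fin.last N) : ℕ) < N + 1 := (p (Fin.last N)).isLt
      have hpar : rrtParent p (Fin.last (N + 1)) = Fin.castSucc ⟨p (Fin.last N), hlt⟩ :=
        Fin.ext (val_rrtParent_last p)
      rw [mem_rrtSubtree_iff, hpar]
      exact Or.inr (key _)
    | cast w => exact key w

lemma ncard_rrtSubtree (N : ℕ) (p : Attachments (N + 1)) (v : Fin (N + 1)) (hv : (v : ℕ) ≠ 0) :
    (rrtSubtree p v).ncard = (labelsBelow v (forest N p)).card + 1 := by
  have h : Fin.val '' rrtSubtree p v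
      = (insert (v : ℕ) (labelsBelow v (forest N p)) : Finset ℕ) := by
    ext y
    simp only [Set.mem_image, mem_rrtSubtree_iff_labelsBelow N p v _ hv, Finset.coe_insert,
      Set.mem_insert_iff, Finset.mem_coe]
    constructor
    · rintro ⟨w, rfl | hw, rfl⟩
      exacts [Or.inl rfl, Or.inr hw]
    · rintro (rfl | hy)
      · exact ⟨v, Or.inl rfl, rfl⟩
      · have := (mem_labels_of_mem_labelsBelow hy).1
        rw [labels_forest, Finset.mem_Icc] at this
        exact ⟨⟨y, by omega⟩, Or.inr hy, rfl⟩
  rw [← Set.ncard_image_of_injective _ Fin.val_injective, h, Set.ncard_coe_finset,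
    Finset.card_insert_of_notMem (notMem_labelsBelow_self (distinctLabels_forest N p) v)]

/-- The root carries the whole tree and accounts for the indicator; all other nodes are seen in the
forest. -/
lemma rrtCount_eq (N k : ℕ) (p : Attachments (N + 1)) :
    rrtCount (N + 1) k p
      = childCount k 0 (shape (forest N p)) + if N + 1 = k then 1 else 0 := by
  classical
  have h0 : (rrtSubtree p 0).ncard = N + 1 := by
    rw [Set.eq_univ_of_forall (mem_rrtSubtree_zero N p), Set.ncard_univ, Nat.card_fin]
  have hs : {v : Fin (N + 1) | (rrtSubtree p v).ncard = k}
      = (Finset.univ.filter fun v : Fin (N + 1) => (rrtSubtree p v).ncard = k : Finset _) := by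
    ext v; simp
  have hl : labels (forest N p) = (Finset.range N).map (addRightEmbedding 1) := by
    rw [labels_forest]
    ext y
    simp only [Finset.mem_Icc, Finset.mem_map, Finset.mem_range, addRightEmbedding_apply]
    exact ⟨fun h => ⟨y - 1, by omega⟩, by rintro ⟨x, hx, rfl⟩; omega⟩
  rw [rrtCount, hs, Set.ncard_coe_finset, childCount_eq_card (distinctLabels_forest N p),
    Finset.card_filter, Finset.card_filter, Fin.sum_univ_succ, h0, hl, Finset.sum_map,
    Finset.sum_range]
  have : ∀ i : Fin N, (rrtSubtree p i.succ).ncard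
      = (labelsBelow ((i : ℕ) + 1) (forest N p)).card + 1 := fun i => by
    rw [ncard_rrtSubtree N p i.succ (by simp), Fin.val_succ]
  simp only [this, addRightEmbedding_apply]
  push_cast
  ring

/-! ### Asymptotic normality -/

lemma integral_uniformOn_univ {Ω 𝕜 : Type*} [RCLike 𝕜] [Fintype Ω] [Nonempty Ω]
    [MeasurableSpace Ω] [MeasurableSingletonClass Ω] (f : Ω → 𝕜) :
    ∫ ω, f ω ∂(uniformOn (Set.univ : Set Ω)) = (∑ ω, f ω) / Fintype.card Ω := by
  have : ∀ ω : Ω, (uniformOn (Set.univ : Set Ω)).real {ω} = (Fintype.card Ω : ℝ)⁻¹ := by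
    intro ω
    rw [measureReal_def, uniformOn_univ, Measure.count_singleton]
    simp
  rw [integral_fintype Integrable.of_finite]
  simp only [this]
  rw [← Finset.smul_sum, RCLike.real_smul_eq_coe_mul, div_eq_inv_mul]
  simp

lemma integral_bstCount {𝕜 : Type*} [RCLike 𝕜] {n k : ℕ} (hk : 1 ≤ k) (hn : n ≠ k) (f : ℝ → 𝕜) :
    ∫ σ, f (bstCount n k σ) ∂(bstMeasure n) = treeMean n fun x => f (childCount (k + 1) 1 x) := by
  have h : ∀ σ : Equiv.Perm (Fin n), bstCount n k σ = childCount (k + 1) 1 (shape (bst σ)) := by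
    intro σ
    rw [bstCount, fringeCount_eq hk, numNodes_bst, if_neg hn, add_zero]
  simp only [h]
  rw [bstMeasure, integral_uniformOn_univ,
    sum_perm_shape_bst n fun x => f (childCount (k + 1) 1 x), Fintype.card_perm, Fintype.card_fin,
    treeMean]

lemma integral_rrtCount {𝕜 : Type*} [RCLike 𝕜] {N k : ℕ} (hn : N + 1 ≠ k) (f : ℝ → 𝕜) :
    ∫ p, f (rrtCount (N + 1) k p) ∂(rrtMeasure (N + 1)) = treeMean N fun x => f (childCount k 0 x) := by
  have h : ∀ p : Attachments (N + 1), rrtCount (N + 1) k p = childCount k 0 (shape (forest N p)) := by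
    intro p
    rw [rrtCount_eq, if_neg hn, add_zero]
  have hcard : (Fintype.card (Attachments (N + 1)) : 𝕜) = N.factorial := by
    rw [← growthSum_one, ← sum_attachments_shape, Finset.sum_const, nsmul_one, Finset.card_univ]
  simp only [h]
  rw [rrtMeasure, integral_uniformOn_univ,
    sum_attachments_shape N fun x => f (childCount k 0 x), hcard, treeMean]

section Limit

variable {Ω : ℕ → Type*} {mΩ : ∀ n, MeasurableSpace (Ω n)}
  [∀ n, DiscreteMeasurableSpace (Ω n)] {μ : ∀ n, Measure (Ω n)} [∀ n, IsProbabilityMeasure (μ n)]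

/-- Lévy's continuity theorem reduces the claim to pointwise convergence of characteristic
functions. The law of X enters through real test functions for the mean and variance and through
complex ones for the characteristic function. -/
lemma tendstoInDistribution_standardize (X : ∀ n, Ω n → ℝ) (K N : ℕ → ℕ) {b : ℝ} (hb : 0 ≤ b)
    (hb1 : b ≤ 1) (hK : ∀ᶠ n in atTop, 1 ≤ K n) (hbK : ∀ᶠ n in atTop, 1 + b ≤ K n)
    (hKN : Tendsto (fun n => ((N n : ℝ) + 1) / (K n : ℝ) ^ 2) atTop atTop)
    (hlaw : ∀ᶠ n in atTop, ∀ f : ℝ → ℝ,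
      ∫ ω, f (X n ω) ∂(μ n) = treeMean (N n) fun x => f (childCount (K n) b x))
    (hlaw' : ∀ᶠ n in atTop, ∀ f : ℝ → ℂ,
      ∫ ω, f (X n ω) ∂(μ n) = treeMean (N n) fun x => f (childCount (K n) b x)) :
    TendstoInDistribution (fun n => standardize (X n) (μ n)) atTop (fun x : ℝ => x) μ
      (gaussianReal 0 1) := by
  have hmeas : ∀ n, AEMeasurable (standardize (X n) (μ n)) (μ n) := fun n =>
    Measurable.of_discrete.aemeasurable
  refine ⟨hmeas, aemeasurable_id', ProbabilityMeasure.tendsto_iff_tendsto_charFun.2 fun t => ?_⟩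
  set V : ℕ → ℝ := fun n => treeVariance (K n) b (N n) with hV
  have hlarge : ∀ᶠ n in atTop, 2 * K n ≤ N n := by
    -- For K ≥ 1, the bound N + 1 ≥ 4K² implies N ≥ 2K.
    filter_upwards [hK, hKN.eventually_ge_atTop 4] with n h1 h2
    have h3 : (1 : ℝ) ≤ K n := by exact_mod_cast h1
    rw [le_div_iff₀ (by positivity)] at h2
    have h4 : (2 * K n : ℝ) ≤ N n := by nlinarith
    exact_mod_cast h4
  have hVtop : Tendsto V atTop atTop := by
    refine tendsto_atTop_mono' _ ?_ (hKN.const_mul_atTop (by norm_num : (0 : ℝ) < 1 / 54))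
    filter_upwards [hK, hbK, hlarge] with n h1 h2 h3
    have h4 := le_varianceSlope h2 hb1 h1
    calc 1 / 54 * (((N n : ℝ) + 1) / (K n : ℝ) ^ 2) = 1 / (54 * (K n : ℝ) ^ 2) * (N n + 1) := by
          have : (K n : ℝ) ≠ 0 := by positivity
          field_simp
      _ ≤ varianceSlope (K n) b * (N n + 1) := by gcongr
      _ = V n := (treeVariance_eq h1 _ h3).symm
  have hsqrt : Tendsto (fun n => √(V n)) atTop atTop := Real.tendsto_sqrt_atTop.comp hVtop
  have hchar : ∀ᶠ n in atTop, charFun ((μ n).map (standardize (X n) (μ n))) t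
      = centredChar (K n) b (t / √(V n)) (N n) := by
    filter_upwards [hK, hlaw, hlaw'] with n h1 h2 h3
    have hmean : ∫ ω, X n ω ∂(μ n) = centre (K n) b (N n) := by
      have h4 := treeMean_childCount_sub_centre (b := b) h1 (N n)
      have h5 := treeMean_add (N n) (fun x => childCount (K n) b x)
        fun _ => -centre (K n) b (N n)
      rw [treeMean_const] at h5
      simp only [sub_eq_add_neg] at h4
      rw [h2 fun x => x]
      linarith
    have hvar : variance (X n) (μ n) = V n := by
      rw [variance_eq_integral Measurable.of_discrete.aemeasurable, hmean,
        h2 fun x => (x - centre (K n) b (N n)) ^ 2]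
      rfl
    rw [charFun_apply_real, integral_map (hmeas n) (by fun_prop)]
    simp only [standardize, hmean, hvar]
    rw [h3 fun x => Complex.exp (t * ((x - centre (K n) b (N n)) / √(V n) : ℝ) * Complex.I),
      centredChar]
    congr 1
    funext x
    congr 2
    push_cast
    ring
  have hgauss : ∀ᶠ n in atTop, gaussChar (K n) b (t / √(V n)) (N n)
      = charFun ((gaussianReal 0 1).map fun x : ℝ => x) t := by
    filter_upwards [hVtop.eventually_gt_atTop 0] with n h1
    rw [Measure.map_id', charFun_gaussianReal, gaussChar]
    congr 1
    have h2 : (t / √(V n)) ^ 2 * treeVariance (K n) b (N n) = t ^ 2 := by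
      rw [div_pow, Real.sq_sqrt h1.le]
      exact div_mul_cancel₀ _ h1.ne'
    rw [h2]
    simp
  have hbound : ∀ᶠ n in atTop, ‖charFun ((μ n).map (standardize (X n) (μ n))) t
      - charFun ((gaussianReal 0 1).map fun x : ℝ => x) t‖
      ≤ 3240000 * |t| ^ 3 * (√(V n))⁻¹ := by
    filter_upwards [hchar, hgauss, hK, hbK, hlarge, hsqrt.eventually_ge_atTop (100 * |t|),
      hVtop.eventually_gt_atTop 0] with n h1 h2 h3 h4 h5 h6 h7
    have h8 : 0 < √(V n) := Real.sqrt_pos.2 h7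
    have habs : |t / √(V n)| = |t| / √(V n) := by rw [abs_div, abs_of_pos h8]
    have hs : |t / √(V n)| ≤ 1 / 100 := by
      rw [habs, div_le_iff₀ h8]; linarith
    rw [h1, ← h2]
    -- At s = t/√V the factor |s|³V collapses to |t|³/√V.
    refine (norm_centredChar_sub_gaussChar_le hb hb1 h4 h3 hs h5).trans (le_of_eq ?_)
    have h9 : treeVariance (K n) b (N n) = √(V n) ^ 2 := (Real.sq_sqrt h7.le).symm
    rw [h9, habs]
    field_simp
  rw [tendsto_iff_norm_sub_tendsto_zero]
  refine squeeze_zero' (Eventually.of_forall fun _ => norm_nonneg _) hbound ?_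
  simpa using (tendsto_inv_atTop_zero.comp hsqrt).const_mul (3240000 * |t| ^ 3)

end Limit

lemma tendsto_div_sq_atTop {k : ℕ → ℕ} (hk_pos : ∀ᶠ n in atTop, 1 ≤ k n)
    (hk : (fun n : ℕ => (k n : ℝ)) =o[atTop] fun n : ℕ => √(n : ℝ)) :
    Tendsto (fun n : ℕ => (n : ℝ) / (k n : ℝ) ^ 2) atTop atTop := by
  have h1 : Tendsto (fun n : ℕ => (k n : ℝ) / √(n : ℝ)) atTop (nhdsWithin 0 (Set.Ioi 0)) := by
    refine tendsto_nhdsWithin_iff.2 ⟨hk.tendsto_div_nhds_zero, ?_⟩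
    filter_upwards [hk_pos, eventually_gt_atTop 0] with n h1 h2
    have h3 : (0 : ℝ) < k n := by exact_mod_cast h1
    have h4 : (0 : ℝ) < n := by exact_mod_cast h2
    exact div_pos h3 (Real.sqrt_pos.2 h4)
  refine ((tendsto_pow_atTop two_ne_zero).comp h1.inv_tendsto_nhdsGT_zero).congr fun n => ?_
  simp only [Function.comp_apply, Pi.inv_apply, inv_div, div_pow]
  rw [Real.sq_sqrt (Nat.cast_nonneg n)]

end FringeTrees

/-! ### Specialization to the two tree models. -/

theorem theorem2 (k : ℕ → ℕ) (hk_pos : ∀ᶠ n in atTop, 1 ≤ k n)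
    (hk : (fun n : ℕ => (k n : ℝ)) =o[atTop] fun n : ℕ => √(n : ℝ)) :
    TendstoInDistribution
        (fun n => FringeTrees.standardize (FringeTrees.bstCount n (k n)) (FringeTrees.bstMeasure n))
        atTop (fun x : ℝ => x) FringeTrees.bstMeasure (gaussianReal 0 1) ∧
      TendstoInDistribution
        (fun n => FringeTrees.standardize (FringeTrees.rrtCount n (k n)) (FringeTrees.rrtMeasure n))
        atTop (fun x : ℝ => x) FringeTrees.rrtMeasure (gaussianReal 0 1) := by
  have htop := FringeTrees.tendsto_div_sq_atTop hk_pos hk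
  have hlt : ∀ᶠ n in atTop, k n < n := by
    filter_upwards [hk_pos, htop.eventually_gt_atTop 1] with n h1 h2
    have h3 : (1 : ℝ) ≤ k n := by exact_mod_cast h1
    rw [lt_div_iff₀ (by positivity)] at h2
    have : (k n : ℝ) < n := by nlinarith
    exact_mod_cast this
  constructor
  · refine FringeTrees.tendstoInDistribution_standardize (fun n => FringeTrees.bstCount n (k n))
      (fun n => k n + 1) (fun n => n) zero_le_one le_rfl
      (Eventually.of_forall fun n => Nat.le_add_left 1 (k n)) ?_ ?_ ?_ ?_
    · filter_upwards [hk_pos] with n h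
      have : (1 : ℝ) ≤ k n := by exact_mod_cast h
      push_cast; linarith
    -- The factor 1/4 absorbs the shift from k to K = k + 1, since (k + 1)² ≤ 4k².
    · refine tendsto_atTop_mono' _ ?_ (htop.const_mul_atTop (by norm_num : (0 : ℝ) < 1 / 4))
      filter_upwards [hk_pos] with n h
      have h1 : (1 : ℝ) ≤ k n := by exact_mod_cast h
      have h2 : (0 : ℝ) ≤ n := n.cast_nonneg
      rw [one_div_mul_eq_div, div_div]
      push_cast
      gcongr
      · linarith
      · nlinarith
    · filter_upwards [hk_pos, hlt] with n h1 h2 f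
      exact FringeTrees.integral_bstCount h1 h2.ne' f
    · filter_upwards [hk_pos, hlt] with n h1 h2 f
      exact FringeTrees.integral_bstCount h1 h2.ne' f
  · refine FringeTrees.tendstoInDistribution_standardize (fun n => FringeTrees.rrtCount n (k n))
      -- The forest omits the root, so the grown tree has n - 1 nodes; a subtree of size k
      -- corresponds to a left subtree of size k - 1, whence K = k.
      k (fun n => n - 1) le_rfl zero_le_one hk_pos ?_ ?_ ?_ ?_
    · filter_upwards [hk_pos] with n h
      rw [add_zero]; exact_mod_cast h
    · refine htop.congr' ?_
      filter_upwards [eventually_ge_atTop 1] with n hn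
      push_cast [hn]
      ring
    · filter_upwards [hlt] with n h f
      obtain ⟨N, rfl⟩ : ∃ N, n = N + 1 := ⟨n - 1, by omega⟩
      exact FringeTrees.integral_rrtCount h.ne' f
    · filter_upwards [hlt] with n h f
      obtain ⟨N, rfl⟩ : ∃ N, n = N + 1 := ⟨n - 1, by omega⟩
      exact FringeTrees.integral_rrtCount h.ne' f
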